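/- Let $k$ be a field of characteristic different from $2$. Let $B=k\langle y_1,y_2\rangle/(y_1^2,\,y_2^2,\,y_1y_2+y_2y_1)$ and let $A=B\rtimes k\langle g\rangle$ be the skew group algebra of $B$ by the cyclic group $\langle g\rangle$ of order $2$ acting by $gy_ig^{-1}=-y_i$ $(i=1,2)$. Regard $A$ as a bialgebra with comultiplication $\Delta(g)=g\otimes g$, $\Delta(y_i)=1\otimes y_i+y_i\otimes g$ and counit $\varepsilon(g)=1$, $\varepsilon(y_i)=0$, and let $k$ also denote the trivial module, on which $A$ acts through $\varepsilon$. For $A$-modules $M$ and $N$ put $\operatorname{Ext}^*_A(M,N)=\bigoplus_{n\ge 0}\operatorname{Ext}^n_A(M,N)$; then $\operatorname{Ext}^*_A(k,k)$ is a $k$-algebra under the Yoneda product. The exact functor $-\otimes_k M$, together with $k\otimes_k M\cong M$, induces a ring homomorphism $\psi_M:\operatorname{Ext}^*_A(k,k)\to\operatorname{Ext}^*_A(M,M)$, and $\operatorname{Ext}^*_A(M,N)$ is a module over $\operatorname{Ext}^*_A(k,k)$ by letting $\zeta$ act as Yoneda composition with $\psi_M(\zeta)$, that is, $\alpha\mapsto\alpha\circ\psi_M(\zeta)$.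 Then $\operatorname{Ext}^*_A(k,k)$ is a finitely generated $k$-algebra, and for all finitely generated $A$-modules $M$ and $N$ the module $\operatorname{Ext}^*_A(M,N)$ is finitely generated over $\operatorname{Ext}^*_A(k,k)$. -/

import Mathlib

universe u

namespace ExtFG

section Alg
open scoped TensorProduct

/-- The defining relations `y₀² = y₁² = 0`, `y₀ y₁ + y₁ y₀ = 0` on the free algebra `k⟨y₀, y₁⟩`.
The two generators are indexed by `Fin 2`. -/
inductive ExtRel (k : Type u) [Field k] : FreeAlgebra k (Fin 2) → FreeAlgebra k (Fin 2) → Prop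
  | sq (i : Fin 2) : ExtRel k (FreeAlgebra.ι k i * FreeAlgebra.ι k i) 0
  | anticomm : ExtRel k (FreeAlgebra.ι k 0 * FreeAlgebra.ι k 1 + FreeAlgebra.ι k 1 * FreeAlgebra.ι k 0) 0

/-- The algebra `B = k⟨y₀, y₁⟩ / (y₀², y₁², y₀ y₁ + y₁ y₀)`. -/
def AlgB (k : Type u) [Field k] : Type u := RingQuot (ExtRel k)

namespace AlgB
variable (k : Type u) [Field k]

noncomputable instance : Ring (AlgB k) := inferInstanceAs (Ring (RingQuot (ExtRel k)))
noncomputable instance : Algebra k (AlgB k) := inferInstanceAs (Algebra k (RingQuot (ExtRel k)))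

/-- The generator `yᵢ` of `B`. -/
noncomputable def y (i : Fin 2) : AlgB k := RingQuot.mkAlgHom k (ExtRel k) (FreeAlgebra.ι k i)

theorem y_sq (i : Fin 2) : y k i * y k i = 0 := by
  have h := RingQuot.mkAlgHom_rel k (ExtRel.sq (k := k) i)
  rw [map_mul, map_zero] at h
  exact h

theorem y_anticomm : y k 0 * y k 1 + y k 1 * y k 0 = 0 := by
  have h := RingQuot.mkAlgHom_rel k (ExtRel.anticomm (k := k))
  rw [map_add, map_mul, map_mul, map_zero] at h
  exact h

variable {k} {C : Type*} [Ring C] [Algebra k C]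

/-- Universal property of `B`. -/
noncomputable def lift (f : Fin 2 → C) (hsq : ∀ i, f i * f i = 0)
    (hanti : f 0 * f 1 + f 1 * f 0 = 0) : AlgB k →ₐ[k] C :=
  RingQuot.liftAlgHom k ⟨FreeAlgebra.lift k f, by
    rintro _ _ (i | _)
    · simp [hsq]
    · simp [hanti]⟩

@[simp] theorem lift_y (f : Fin 2 → C) (hsq : ∀ i, f i * f i = 0)
    (hanti : f 0 * f 1 + f 1 * f 0 = 0) (i : Fin 2) :
    lift (k := k) f hsq hanti (y k i) = f i := by
  unfold lift y
  erw [RingQuot.liftAlgHom_mkAlgHom_apply]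
  simp

theorem algHom_ext {f g : AlgB k →ₐ[k] C} (h : ∀ i, f (y k i) = g (y k i)) : f = g := by
  refine RingQuot.ringQuot_ext' k f g ?_
  refine FreeAlgebra.hom_ext ?_
  funext i
  exact h i

variable (k)

/-- The algebra automorphism `yᵢ ↦ -yᵢ` of `B`. -/
noncomputable def sgn : AlgB k →ₐ[k] AlgB k :=
  lift (fun i => - y k i) (fun i => by simp [y_sq]) (by simp [y_anticomm])

@[simp] theorem sgn_y (i : Fin 2) : sgn k (y k i) = - y k i := lift_y ..

theorem sgn_sq : sgn k * sgn k = 1 := algHom_ext fun i => by simp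

end AlgB

/-- The cyclic group `⟨g⟩` of order two, written multiplicatively. -/
abbrev C2 : Type := Multiplicative (ZMod 2)

namespace C2
/-- The generator of the group of order two. -/
def g : C2 := Multiplicative.ofAdd 1

/-- The homomorphism `g ↦ x` to a monoid, for an element with `x² = 1`. -/
def homOfSq {M : Type*} [Monoid M] (x : M) (hx : x * x = 1) : C2 →* M where
  toFun u := x ^ (Multiplicative.toAdd u).val
  map_one' := by simp
  map_mul' u v := by
    rw [← pow_add, toAdd_mul, ZMod.val_add]
    exact (pow_eq_pow_mod _ (by rw [pow_two, hx])).symm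

theorem homOfSq_g {M : Type*} [Monoid M] (x : M) (hx : x * x = 1) : homOfSq x hx g = x :=
  pow_one x

theorem g_mul_g : g * g = 1 := rfl

theorem eq_one_or_g (u : C2) : u = 1 ∨ u = g := by
  revert u; decide
end C2

namespace AlgB
variable (k : Type u) [Field k]

/-- The homomorphism through which `⟨g⟩` acts on `B`: the generator acts by `yᵢ ↦ -yᵢ`. -/
noncomputable def actionHom : C2 →* (AlgB k →ₐ[k] AlgB k) := C2.homOfSq (sgn k) (sgn_sq k)

/-- The action of `⟨g⟩` on `B` by algebra automorphisms, with `g • yᵢ = -yᵢ`. -/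
noncomputable instance : MulSemiringAction C2 (AlgB k) where
  smul u b := actionHom k u b
  one_smul b := by change actionHom k 1 b = b; simp
  mul_smul u v b := by
    change actionHom k (u * v) b = actionHom k u (actionHom k v b); simp
  smul_zero u := map_zero (actionHom k u)
  smul_add u := map_add (actionHom k u)
  smul_one u := map_one (actionHom k u)
  smul_mul u := map_mul (actionHom k u)

theorem g_smul (b : AlgB k) : C2.g • b = sgn k b := by
  change actionHom k C2.g b = _
  rw [actionHom, C2.homOfSq_g]

instance : SMulCommClass C2 k (AlgB k) where
  smul_comm u c b := map_smul (actionHom k u) c b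

end AlgB

/-- The algebra `A = B ⋊ k⟨g⟩`: the skew group algebra of `B` by the group of order two, so that
`g² = 1` and `g yᵢ g⁻¹ = -yᵢ`. -/
abbrev AlgA (k : Type u) [Field k] : Type u := SkewMonoidAlgebra (AlgB k) C2

namespace AlgA
variable (k : Type u) [Field k]

/-- The inclusion of `B` in `A`. -/
noncomputable def incl : AlgB k →ₐ[k] AlgA k where
  toFun b := SkewMonoidAlgebra.single 1 b
  map_one' := rfl
  map_mul' a b := by simp [SkewMonoidAlgebra.single_mul_single]
  map_zero' := by simp
  map_add' a b := SkewMonoidAlgebra.single_add ..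
  commutes' c := rfl

theorem incl_apply (b : AlgB k) : incl k b = SkewMonoidAlgebra.single 1 b := rfl

/-- The element `yᵢ` of `A`. -/
noncomputable def y (i : Fin 2) : AlgA k := incl k (AlgB.y k i)

/-- The element `g` of `A`. -/
noncomputable def g : AlgA k := SkewMonoidAlgebra.single C2.g 1

theorem y_sq (i : Fin 2) : y k i * y k i = 0 := by
  rw [y, ← map_mul, AlgB.y_sq, map_zero]

theorem y_anticomm : y k 0 * y k 1 + y k 1 * y k 0 = 0 := by
  simp only [y, ← map_mul, ← map_add, AlgB.y_anticomm, map_zero]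

theorem g_sq : g k * g k = 1 := by
  simp [g, SkewMonoidAlgebra.single_mul_single, C2.g_mul_g]

theorem g_mul_incl (b : AlgB k) : g k * incl k b = incl k (AlgB.sgn k b) * g k := by
  simp [g, incl_apply, SkewMonoidAlgebra.single_mul_single, AlgB.g_smul]

theorem g_mul_y (i : Fin 2) : g k * y k i = - (y k i * g k) := by
  rw [y, g_mul_incl, AlgB.sgn_y, map_neg, neg_mul]

variable {k} {C : Type*} [Ring C] [Algebra k C]

/-- Universal property of `A`. -/
noncomputable def lift (f : Fin 2 → C) (c : C) (hsq : ∀ i, f i * f i = 0)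
    (hanti : f 0 * f 1 + f 1 * f 0 = 0) (hc : c * c = 1) (hcf : ∀ i, c * f i = - (f i * c)) :
    AlgA k →ₐ[k] C :=
  SkewMonoidAlgebra.liftNCAlgHom (AlgB.lift f hsq hanti) (C2.homOfSq c hc) (by
    have key : ∀ x : AlgB k, AlgB.lift f hsq hanti (AlgB.sgn k x) =
        c * AlgB.lift f hsq hanti x * c := by
      let conj : C →ₐ[k] C :=
        { toFun := fun x => c * x * c
          map_one' := by simp [hc]
          map_mul' := fun x z => by
            calc c * (x * z) * c = c * x * 1 * z * c := by simp [mul_assoc]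
              _ = _ := by rw [← hc]; simp [mul_assoc]
          map_zero' := by simp
          map_add' := fun x z => by simp [mul_add, add_mul]
          commutes' := fun r => by
            rw [← Algebra.commutes, mul_assoc, hc, mul_one] }
      intro x
      refine DFunLike.congr_fun (f := (AlgB.lift f hsq hanti).comp (AlgB.sgn k))
        (g := conj.comp (AlgB.lift f hsq hanti)) (AlgB.algHom_ext fun i => ?_) x
      simp [conj, hcf]; simp [mul_assoc, hc]
    intro x u
    rcases C2.eq_one_or_g u with rfl | rfl
    · simp
    · rw [AlgB.g_smul, C2.homOfSq_g, key, mul_assoc, hc, mul_one])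

section
variable (f : Fin 2 → C) (c : C) (hsq : ∀ i, f i * f i = 0)
    (hanti : f 0 * f 1 + f 1 * f 0 = 0) (hc : c * c = 1) (hcf : ∀ i, c * f i = - (f i * c))

@[simp] theorem lift_y (i : Fin 2) : lift (k := k) f c hsq hanti hc hcf (y k i) = f i := by
  change SkewMonoidAlgebra.liftNC _ _ (SkewMonoidAlgebra.single _ _) = _
  rw [SkewMonoidAlgebra.liftNC_single]
  simp

@[simp] theorem lift_g : lift (k := k) f c hsq hanti hc hcf (g k) = c := by
  change SkewMonoidAlgebra.liftNC _ _ (SkewMonoidAlgebra.single _ _) = _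
  rw [SkewMonoidAlgebra.liftNC_single]
  simp [C2.homOfSq_g]
end

theorem algHom_ext {f f' : AlgA k →ₐ[k] C} (hy : ∀ i, f (y k i) = f' (y k i))
    (hg : f (g k) = f' (g k)) : f = f' := by
  have hB : f.comp (incl k) = f'.comp (incl k) := AlgB.algHom_ext hy
  apply AlgHom.ext
  intro a
  induction a using SkewMonoidAlgebra.induction_on with
  | zero => simp
  | single u b =>
    have : SkewMonoidAlgebra.single u b = incl k b * SkewMonoidAlgebra.single u (1 : AlgB k) := by
      simp [incl_apply, SkewMonoidAlgebra.single_mul_single]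
    rw [this, map_mul, map_mul]
    congr 1
    · exact DFunLike.congr_fun hB b
    · rcases C2.eq_one_or_g u with rfl | rfl
      · exact (map_one f).trans (map_one f').symm
      · exact hg
  | add a b ha hb => rw [map_add, map_add, ha, hb]

variable (k)

/-- The counit `ε(yᵢ) = 0`, `ε(g) = 1`. -/
noncomputable def counitHom : AlgA k →ₐ[k] k :=
  lift (fun _ => 0) 1 (by simp) (by simp) (by simp) (by simp)

/-- The comultiplication `Δ(yᵢ) = 1 ⊗ yᵢ + yᵢ ⊗ g`, `Δ(g) = g ⊗ g`. -/
noncomputable def comulHom : AlgA k →ₐ[k] AlgA k ⊗[k] AlgA k :=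
  lift (fun i => 1 ⊗ₜ y k i + y k i ⊗ₜ g k) (g k ⊗ₜ g k)
    (fun i => by
      simp [mul_add, add_mul, y_sq, g_mul_y, TensorProduct.tmul_neg])
    (by
      have h1 := congrArg (fun t => (1 : AlgA k) ⊗ₜ[k] t) (y_anticomm k)
      have h2 := congrArg (fun t => t ⊗ₜ[k] (1 : AlgA k)) (y_anticomm k)
      simp only [TensorProduct.tmul_add, TensorProduct.add_tmul, TensorProduct.tmul_zero,
        TensorProduct.zero_tmul] at h1 h2
      simp only [mul_add, add_mul, Algebra.TensorProduct.tmul_mul_tmul, one_mul, mul_one, g_sq,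
        g_mul_y, TensorProduct.tmul_neg]
      generalize (1 : AlgA k) ⊗ₜ[k] (y k 0 * y k 1) = a at *
      generalize (1 : AlgA k) ⊗ₜ[k] (y k 1 * y k 0) = a' at *
      rw [eq_neg_of_add_eq_zero_left h1, eq_neg_of_add_eq_zero_left h2]
      abel)
    (by simp [g_sq, Algebra.TensorProduct.one_def])
    (fun i => by simp [mul_add, add_mul, g_mul_y, TensorProduct.tmul_neg, TensorProduct.neg_tmul,
      add_comm])

/-- The bialgebra structure of `A` given by `Δ` and `ε`. -/
noncomputable instance : Bialgebra k (AlgA k) :=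
  Bialgebra.ofAlgHom (comulHom k) (counitHom k)
    (algHom_ext (fun i => by
      simp [comulHom, TensorProduct.tmul_add, TensorProduct.add_tmul, add_assoc,
        Algebra.TensorProduct.one_def]) (by simp [comulHom]))
    (algHom_ext (fun i => by simp [comulHom, counitHom]) (by simp [comulHom, counitHom]))
    (algHom_ext (fun i => by simp [comulHom, counitHom]) (by simp [comulHom, counitHom]))

end AlgA
end Alg

section ExtPart
open CategoryTheory Abelian
open scoped TensorProduct DirectSum

namespace ExtRingOf
variable {H : Type u} [Ring H]

theorem mk_comp {X Y Z : ModuleCat.{u} H} {a b c c' : ℕ} (α : Ext X Y a) (β : Ext Y Z b)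
    (h : a + b = c) (h' : a + b = c') :
    (GradedMonoid.mk c (α.comp β h) : GradedMonoid fun n : ℕ => Ext X Z n) =
      GradedMonoid.mk c' (α.comp β h') := by
  subst h; subst h'; rfl

/-- Yoneda product on `Ext*(X, X)`, in diagrammatic order: `α * β` is `α` followed by `β`. -/
noncomputable instance gmul (X : ModuleCat.{u} H) :
    GradedMonoid.GMul (fun n : ℕ => Ext X X n) where
  mul α β := α.comp β rfl

noncomputable instance gone (X : ModuleCat.{u} H) :
    GradedMonoid.GOne (fun n : ℕ => Ext X X n) where
  one := Ext.mk₀ (𝟙 X)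

noncomputable instance gmonoid (X : ModuleCat.{u} H) :
    GradedMonoid.GMonoid (fun n : ℕ => Ext X X n) where
  one_mul := by
    rintro ⟨n, α⟩
    refine (mk_comp (Ext.mk₀ (𝟙 X)) α _ (zero_add n)).trans ?_
    rw [Ext.mk₀_id_comp]
    rfl
  mul_one := by
    rintro ⟨n, α⟩
    refine (mk_comp α (Ext.mk₀ (𝟙 X)) _ (add_zero n)).trans ?_
    rw [Ext.comp_mk₀_id]
    rfl
  mul_assoc := by
    rintro ⟨n, α⟩ ⟨m, β⟩ ⟨p, γ⟩
    refine Eq.trans ?_ (mk_comp α (β.comp γ rfl) (add_assoc n m p).symm rfl)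
    rw [← Ext.comp_assoc α β γ rfl rfl rfl]
    rfl

/-- `Ext*(X, X)` is a graded ring under the Yoneda product. -/
noncomputable instance gring (X : ModuleCat.{u} H) : DirectSum.GRing (fun n : ℕ => Ext X X n) where
  mul_zero _ := Ext.comp_zero ..
  zero_mul _ := Ext.zero_comp ..
  mul_add _ _ _ := Ext.comp_add ..
  add_mul _ _ _ := Ext.add_comp ..
  natCast n := n • Ext.mk₀ (𝟙 X)
  natCast_zero := zero_smul ℕ _
  natCast_succ _ := succ_nsmul _ _
  intCast n := n • Ext.mk₀ (𝟙 X)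
  intCast_ofNat _ := natCast_zsmul _ _
  intCast_negSucc_ofNat _ := negSucc_zsmul _ _

variable (k : Type u) [Field k] [Algebra k H]

/-- `Ext*(X, X)` is a graded `k`-algebra when `H` is a `k`-algebra. -/
noncomputable instance galgebra (X : ModuleCat.{u} H) :
    DirectSum.GAlgebra k (fun n : ℕ => Ext X X n) where
  toFun := (smulAddHom k (Ext X X 0)).flip (Ext.mk₀ (𝟙 X))
  map_one := one_smul k (Ext.mk₀ (𝟙 X))
  map_mul r s := by
    refine Eq.trans ?_ (mk_comp (r • Ext.mk₀ (𝟙 X)) (s • Ext.mk₀ (𝟙 X)) (zero_add 0) rfl)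
    rw [Ext.smul_comp, Ext.mk₀_id_comp, smul_smul]
    rfl
  commutes := by
    rintro r ⟨n, α⟩
    refine (mk_comp (r • Ext.mk₀ (𝟙 X)) α _ (zero_add n)).trans
      (Eq.trans ?_ (mk_comp α (r • Ext.mk₀ (𝟙 X)) (add_zero n) rfl))
    rw [Ext.smul_comp, Ext.mk₀_id_comp, Ext.comp_smul, Ext.comp_mk₀_id]
  smul_def := by
    rintro r ⟨n, α⟩
    refine Eq.trans ?_ (mk_comp (r • Ext.mk₀ (𝟙 X)) α (zero_add n) rfl)
    rw [Ext.smul_comp, Ext.mk₀_id_comp]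
    rfl
end ExtRingOf

namespace BialgMod
variable (k : Type u) [Field k] {H : Type u} [Ring H] [Bialgebra k H]
open scoped ModuleCat

/-- The algebra map `H → H ⊗ H → End(X) ⊗ End(M) → End(X ⊗ M)` by which a bialgebra acts on the
tensor product of two modules: `h (x ⊗ m) = ∑ h₁ x ⊗ h₂ m`. -/
noncomputable def action (X M : ModuleCat.{u} H) : H →ₐ[k] Module.End k (X ⊗[k] M) :=
  (Module.endTensorEndAlgHom (R := k) (S := k) (A := k) (M := X) (N := M)).comp
    ((Algebra.TensorProduct.map (Algebra.lsmul k k X) (Algebra.lsmul k k M)).comp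
      (Bialgebra.comulAlgHom k H))

/-- The `H`-module `X ⊗ₖ M`. -/
noncomputable def tensorObj (X M : ModuleCat.{u} H) : ModuleCat.{u} H :=
  @ModuleCat.of H _ (X ⊗[k] M) _ (Module.compHom _ (action k X M).toRingHom)

variable {k} in
theorem map_aux {X Y M : ModuleCat.{u} H} (f : X →ₗ[k] Y) (hf : ∀ (h : H) x, f (h • x) = h • f x) (h : H)
   (t : X ⊗[k] M) : f.rTensor M (action k X M h t) = action k Y M h (f.rTensor M t) := by
  have : ∀ d : H ⊗[k] H, f.rTensor M (Module.endTensorEndAlgHom (R := k) (S := k) (A := k) (M := X) (N := M) (Algebra.TensorProduct.map (Algebra.lsmul k k X) (Algebra.lsmul k k M) d) t) =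
     Module.endTensorEndAlgHom (R := k) (S := k) (A := k) (M := Y) (N := M) (Algebra.TensorProduct.map (Algebra.lsmul k k Y) (Algebra.lsmul k k M) d) (f.rTensor M t) := by
    intro d
    induction d using TensorProduct.induction_on with
    | zero => simp
    | add a b ha hb => simp only [map_add, LinearMap.add_apply, ha, hb]
    | tmul a b =>
      induction t using TensorProduct.induction_on with
      | zero => simp
      | add a b ha hb => simp only [map_add,  ha, hb]
      | tmul x m =>
        rw [Algebra.TensorProduct.map_tmul, Algebra.TensorProduct.map_tmul, LinearMap.rTensor_tmul,
          Module.endTensorEndAlgHom_apply, Module.endTensorEndAlgHom_apply,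
          TensorProduct.AlgebraTensorModule.map_tmul, TensorProduct.AlgebraTensorModule.map_tmul,
          LinearMap.rTensor_tmul]
        simp only [Algebra.lsmul_coe, hf]
  exact this _

/-- The functor `- ⊗ₖ M` on `H`-modules. -/
noncomputable def tensorFunctor (M : ModuleCat.{u} H) : ModuleCat.{u} H ⥤ ModuleCat.{u} H where
  obj X := tensorObj k X M
  map {X Y} f := ModuleCat.ofHom (X := tensorObj k X M) (Y := tensorObj k Y M)
    { toFun := (f.hom.restrictScalars k).rTensor M
      map_add' := map_add _
      map_smul' := fun h t => map_aux (f.hom.restrictScalars k) (fun h x => f.hom.map_smul h x) h t }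
  map_id X := by
    ext t
    exact LinearMap.congr_fun (LinearMap.rTensor_id M X) t
  map_comp f g := by
    ext t
    exact LinearMap.congr_fun (LinearMap.rTensor_comp M (g.hom.restrictScalars k) (f.hom.restrictScalars k)) t

instance (M : ModuleCat.{u} H) : (tensorFunctor k M).Additive where
  map_add {X Y f g} := by
    ext t
    exact LinearMap.congr_fun (LinearMap.rTensor_add M (f.hom.restrictScalars k) (g.hom.restrictScalars k)) t

theorem exact (M : ModuleCat.{u} H) (S : ShortComplex (ModuleCat.{u} H)) (hS : S.ShortExact) :
    (S.map (tensorFunctor k M)).ShortExact := by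
  have := hS.mono_f
  have := hS.epi_g
  refine ShortComplex.ShortExact.mk' ?_ ?_ ?_
  · rw [ShortComplex.ShortExact.moduleCat_exact_iff_function_exact]
    exact Module.Flat.rTensor_exact (R := k) M (f := S.f.hom.restrictScalars k) (g := S.g.hom.restrictScalars k)
      ((ShortComplex.ShortExact.moduleCat_exact_iff_function_exact _).1 hS.exact)
  · rw [ModuleCat.mono_iff_injective]
    exact Module.Flat.rTensor_preserves_injective_linearMap (R := k) (M := M) (S.f.hom.restrictScalars k)
      ((ModuleCat.mono_iff_injective S.f).1 hS.mono_f)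
  · rw [ModuleCat.epi_iff_surjective]
    exact LinearMap.rTensor_surjective (R := k) M (g := S.g.hom.restrictScalars k)
      ((ModuleCat.epi_iff_surjective S.g).1 hS.epi_g)

theorem preserves (M : ModuleCat.{u} H) : Limits.PreservesFiniteLimits (tensorFunctor k M) ∧
    Limits.PreservesFiniteColimits (tensorFunctor k M) :=
  ((tensorFunctor k M).exact_tfae.out 0 3).1 (exact k M)

instance (M : ModuleCat.{u} H) : Limits.PreservesFiniteLimits (tensorFunctor k M) :=
  (preserves k M).1

instance (M : ModuleCat.{u} H) : Limits.PreservesFiniteColimits (tensorFunctor k M) :=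
  (preserves k M).2

variable (H) in
/-- The trivial module: `k` with `H` acting through the counit. -/
noncomputable def triv : ModuleCat.{u} H :=
  (ModuleCat.restrictScalars (Bialgebra.counitAlgHom k H).toRingHom).obj (ModuleCat.of k k)

/-- The trivial module as a `k`-vector space. -/
noncomputable def trivEquiv : triv k H ≃ₗ[k] k where
  toFun x := x
  invFun x := x
  map_add' _ _ := rfl
  map_smul' c x := by
    change Bialgebra.counitAlgHom k H (algebraMap k H c) * (show k from x) = c * (show k from x)
    rw [AlgHom.commutes]; rfl
  left_inv _ := rfl
  right_inv _ := rfl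

/-- The `k`-linear isomorphism `k ⊗ₖ M ≃ M`, `c ⊗ m ↦ c m`. -/
noncomputable def lid (M : ModuleCat.{u} H) : triv k H ⊗[k] M ≃ₗ[k] M :=
  (TensorProduct.congr (trivEquiv k) (LinearEquiv.refl k M)).trans (TensorProduct.lid k M)

theorem lid_tmul (M : ModuleCat.{u} H) (c : triv k H) (m : M) :
    lid k M (c ⊗ₜ m) = trivEquiv k c • m := rfl

theorem trivEquiv_smul (h : H) (c : triv k H) :
    trivEquiv k (h • c) = Coalgebra.counit (R := k) h * trivEquiv k c := rfl

theorem lid_action (M : ModuleCat.{u} H) (h : H) (t : triv k H ⊗[k] M) :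
    lid k M (action k (triv k H) M h t) = h • lid k M t := by
  have key : ∀ (d : H ⊗[k] H) (c : triv k H) (m : M), lid k M
      (Module.endTensorEndAlgHom (R := k) (S := k) (A := k) (M := triv k H) (N := M)
        (Algebra.TensorProduct.map (Algebra.lsmul k k (triv k H)) (Algebra.lsmul k k M) d)
          (c ⊗ₜ m)) =
      trivEquiv k c • (TensorProduct.lid k H ((Coalgebra.counit (R := k) (A := H)).rTensor H d) • m) := by
    intro d c m
    induction d using TensorProduct.induction_on with
    | zero => simp
    | add a b ha hb => simp only [map_add, LinearMap.add_apply, ha, hb, add_smul, smul_add]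
    | tmul a b =>
      rw [Algebra.TensorProduct.map_tmul, Module.endTensorEndAlgHom_apply,
        TensorProduct.AlgebraTensorModule.map_tmul, lid_tmul, LinearMap.rTensor_tmul,
        TensorProduct.lid_tmul, Algebra.lsmul_coe, Algebra.lsmul_coe, trivEquiv_smul, smul_assoc,
        smul_smul, mul_comm]
  induction t using TensorProduct.induction_on with
  | zero => simp
  | add a b ha hb => simp only [map_add, ha, hb, smul_add]
  | tmul c m =>
    refine (key (Coalgebra.comul h) c m).trans ?_
    rw [Coalgebra.rTensor_counit_comul, TensorProduct.lid_tmul, one_smul, lid_tmul, smul_comm]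

/-- The isomorphism `k ⊗ₖ M ≅ M` of `H`-modules. -/
noncomputable def lidIso (M : ModuleCat.{u} H) : (tensorFunctor k M).obj (triv k H) ≅ M :=
  LinearEquiv.toModuleIso (X₁ := tensorObj k (triv k H) M) (X₂ := M)
    (m₁ := (tensorObj k (triv k H) M).isModule)
    { lid k M with
      map_smul' := lid_action k M }

/-- The map `Extⁿ(k, k) → Extⁿ(M, M)` given by the exact functor `- ⊗ₖ M` and `k ⊗ₖ M ≅ M`. -/
noncomputable def psi (M : ModuleCat.{u} H) (n : ℕ) (ζ : Ext (triv k H) (triv k H) n) : Ext M M n :=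
  (Ext.mk₀ (lidIso k M).inv).comp
    ((ζ.mapExactFunctor (tensorFunctor k M)).comp (Ext.mk₀ (lidIso k M).hom) (add_zero n)) (zero_add n)


theorem psi_one (M : ModuleCat.{u} H) :
    psi k M 0 (Ext.mk₀ (𝟙 (triv k H))) = Ext.mk₀ (𝟙 M) := by
  rw [psi, Ext.mapExactFunctor_mk₀, Ext.mk₀_comp_mk₀, Ext.mk₀_comp_mk₀]
  simp

theorem psi_comp (M : ModuleCat.{u} H) {a b c : ℕ} (ζ : Ext (triv k H) (triv k H) a)
    (ξ : Ext (triv k H) (triv k H) b) (h : a + b = c) :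
    psi k M c (ζ.comp ξ h) = (psi k M a ζ).comp (psi k M b ξ) h := by
  subst h
  simp only [psi, Ext.mapExactFunctor_comp]
  rw [Ext.comp_assoc (Ext.mk₀ (lidIso k M).inv) _ _ (zero_add a) rfl (by omega)]
  congr 1
  rw [Ext.comp_assoc_of_second_deg_zero, ← Ext.comp_assoc (Ext.mk₀ (lidIso k M).hom)
    (Ext.mk₀ (lidIso k M).inv) _ (zero_add 0) (zero_add b) (by omega)]
  rw [Ext.mk₀_comp_mk₀, Iso.hom_inv_id, Ext.mk₀_id_comp, Ext.comp_assoc_of_third_deg_zero]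

theorem psi_zero (M : ModuleCat.{u} H) (n : ℕ) : psi k M n 0 = 0 := by
  simp [psi]

theorem psi_add (M : ModuleCat.{u} H) (n : ℕ) (ζ ξ : Ext (triv k H) (triv k H) n) :
    psi k M n (ζ + ξ) = psi k M n ζ + psi k M n ξ := by
  simp [psi]

/-- The graded algebra `Ext*_H(k, k)`. -/
abbrev ExtAlg (k H : Type u) [Field k] [Ring H] [Bialgebra k H] : Type u :=
  ⨁ n : ℕ, Ext (triv k H) (triv k H) n

/-- The graded group `Ext*_H(M, N)`. -/
def ExtMod (M N : ModuleCat.{u} H) : Type u := ⨁ n : ℕ, Ext M N n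

noncomputable instance (M N : ModuleCat.{u} H) : AddCommGroup (ExtMod M N) :=
  inferInstanceAs (AddCommGroup (⨁ n : ℕ, Ext M N n))

/-- The graded action of `Ext*(k, k)` on `Ext*(M, N)`: `ζ • α` is `psi ζ` followed by `α`. With the
Yoneda products in diagrammatic order this is a left action; with products written in
the order of composition of maps it is the right action `α ∘ psi ζ`. -/
@[reducible] noncomputable def gmodule (M N : ModuleCat.{u} H) :
    DirectSum.Gmodule (fun n : ℕ => Ext (triv k H) (triv k H) n) (fun n : ℕ => Ext M N n) where
  smul {a _} ζ α := (psi k M a ζ).comp α rfl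
  one_smul := by
    rintro ⟨n, α⟩
    refine (ExtRingOf.mk_comp (psi k M 0 (Ext.mk₀ (𝟙 (triv k H)))) α _ (zero_add n)).trans ?_
    rw [psi_one, Ext.mk₀_id_comp]
    rfl
  mul_smul := by
    rintro ⟨a, ζ⟩ ⟨b, ξ⟩ ⟨c, α⟩
    refine (ExtRingOf.mk_comp (psi k M (a + b) (ζ.comp ξ rfl)) α _ rfl).trans
      (Eq.trans ?_ (ExtRingOf.mk_comp (psi k M a ζ) ((psi k M b ξ).comp α rfl)
        (add_assoc a b c).symm rfl))
    rw [psi_comp, Ext.comp_assoc _ _ α rfl rfl rfl]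
  smul_add _ _ _ := Ext.comp_add ..
  smul_zero _ := Ext.comp_zero ..
  add_smul ζ ξ α := by
    change (psi k M _ (ζ + ξ)).comp α rfl = _
    rw [psi_add]
    exact Ext.add_comp ..
  zero_smul α := by
    change (psi k M _ 0).comp α rfl = _
    rw [psi_zero]
    exact Ext.zero_comp ..

/-- `Ext*(M, N)` as a module over `Ext*(k, k)`. -/
noncomputable instance (M N : ModuleCat.{u} H) : Module (ExtAlg k H) (ExtMod M N) :=
  letI := gmodule k M N
  inferInstanceAs (Module (⨁ n : ℕ, Ext (triv k H) (triv k H) n) (⨁ n : ℕ, Ext M N n))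

theorem of_smul_of (M N : ModuleCat.{u} H) {a b : ℕ} (ζ : Ext (triv k H) (triv k H) a) (α : Ext M N b) :
    ((DirectSum.of (fun n : ℕ => Ext (triv k H) (triv k H) n) a ζ : ExtAlg k H) •
     (show ExtMod M N from DirectSum.of (fun n : ℕ => Ext M N n) b α)) =
     DirectSum.of (fun n : ℕ => Ext M N n) (a + b) ((psi k M a ζ).comp α rfl) := by
  let := gmodule k M N
  exact DirectSum.Gmodule.of_smul_of (fun n : ℕ => Ext (triv k H) (triv k H) n) _ ζ α

end BialgMod
end ExtPart

end ExtFG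

/-!
Let `S = k ⊕ k_sgn`, on which both `yᵢ` act by zero. The swap of the two summands anticommutes with
`g`, so it defines for each `i` a self-extension of `S` with class `xᵢ ∈ Ext¹(S, S)`. Carrying this
out with `i = 0` and once more with `i = 1` gives `0 → S → E → S → 0` and `0 → E → P → E → 0`. As
`2 ≠ 0`, the module `P` is cyclic of dimension `8`, hence free of rank one, and `P ⊗ M` is
projective for every `M`.

Put `Tₙ = Extⁿ(S ⊗ M, N)` and `Uₙ = Extⁿ(E ⊗ M, N)`. The second sequence makes `Uₙ → Uₙ₊₁`
surjective, so that all the `Uₙ` are quotients of the finite-dimensional space `U₀`. The images of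
`Tₙ → Uₙ` therefore stabilise, and with the first sequence this gives
`Tₙ₊₁ = x₀ Tₙ + x₁ Tₙ` for large `n`.

The projections of `S` onto its two summands are interchanged when moved past an `xᵢ`, and hence
commute with every `xᵢ xⱼ`. These products therefore restrict to classes in `Ext²(k, k)`, which
act on `Ext*(M, N)`, a direct summand of `T`, and generate it in large degrees.
-/

namespace ExtFG

open Filter CategoryTheory Abelian
open scoped TensorProduct DirectSum ModuleCat

section GradedModules

variable {R : Type*} [Ring R]
  {T : ℕ → Type*} [∀ n, AddCommGroup (T n)] [∀ n, Module R (T n)]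
  {U : ℕ → Type*} [∀ n, AddCommGroup (U n)] [∀ n, Module R (U n)]

/-- A family of operators of degree `d` on a graded module `T` *eventually generates* it if every
component of large enough degree is the sum of their images. -/
def EventuallyGenerates {ι : Type*} {d : ℕ} (X : ι → ∀ n, T n →ₗ[R] T (n + d)) : Prop :=
  ∀ᶠ n in atTop, ⨆ i, LinearMap.range (X i n) = ⊤

section

variable {ι : Type*} {d : ℕ} {X : ι → ∀ n, T n →ₗ[R] T (n + d)}

theorem EventuallyGenerates.comp {X : ι → ∀ n, T n →ₗ[R] T (n + 1)} (hX : EventuallyGenerates X) :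
    EventuallyGenerates (d := 2) fun (i : ι × ι) n ↦ X i.1 (n + 1) ∘ₗ X i.2 n := by
  filter_upwards [hX, (tendsto_add_atTop_nat 1).eventually hX] with n hn hn'
  simp_rw [LinearMap.range_comp, iSup_prod, ← Submodule.map_iSup, hn, Submodule.map_top]
  exact hn'

theorem EventuallyGenerates.of_surjective (hX : EventuallyGenerates X)
    {Y : ι → ∀ n, U n →ₗ[R] U (n + d)} (f : ∀ n, T n →ₗ[R] U n)
    (hf : ∀ n, Function.Surjective (f n))
    (hXY : ∀ i n, Y i n ∘ₗ f n = f (n + d) ∘ₗ X i n) : EventuallyGenerates Y := by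
  filter_upwards [hX] with n hn
  have hrange (i : ι) : LinearMap.range (Y i n) = (LinearMap.range (X i n)).map (f (n + d)) := by
    rw [← LinearMap.range_comp, ← hXY, LinearMap.range_comp_of_range_eq_top _
      (LinearMap.range_eq_top.2 (hf n))]
  simp_rw [hrange, ← Submodule.map_iSup, hn, Submodule.map_top]
  exact LinearMap.range_eq_top.2 (hf (n + d))

theorem EventuallyGenerates.exists_finite_generating_set [∀ n, Module.Finite R (T n)]
    (hX : EventuallyGenerates X) (hd : 0 < d) :
    ∃ S : Set (Σ n, T n), S.Finite ∧ ∀ p : ∀ n, Submodule R (T n),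
      (∀ i n, (p n).map (X i n) ≤ p (n + d)) → (∀ s ∈ S, s.2 ∈ p s.1) → ∀ n, p n = ⊤ := by
  obtain ⟨D, hD⟩ := eventually_atTop.1 hX
  choose G hG using fun n ↦ Module.Finite.fg_top (R := R) (M := T n)
  refine ⟨⋃ n ∈ Finset.range (D + d), Sigma.mk n '' (G n : Set (T n)),
    Set.Finite.biUnion (Finset.finite_toSet _) fun n _ ↦ (G n).finite_toSet.image _,
    fun p hp hS n ↦ ?_⟩
  induction n using Nat.strong_induction_on with
  | _ n ih =>
    rcases lt_or_ge n (D + d) with hn | hn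
    · rw [eq_top_iff, ← hG n, Submodule.span_le]
      exact fun t ht ↦ hS ⟨n, t⟩
        (Set.mem_biUnion (Finset.mem_coe.2 (Finset.mem_range.2 hn)) ⟨t, ht, rfl⟩)
    · obtain ⟨m, rfl⟩ := Nat.exists_eq_add_of_le' ((Nat.le_add_left d D).trans hn)
      rw [eq_top_iff, ← hD m (by omega), iSup_le_iff]
      intro i
      rw [← Submodule.map_top, ← ih m (by omega)]
      exact hp i m

end

theorem isNoetherian_of_surjective_succ (Z : ∀ n, U n →ₗ[R] U (n + 1))
    (hZ : ∀ n, Function.Surjective (Z n)) [IsNoetherian R (U 0)] (n : ℕ) :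
    IsNoetherian R (U n) := by
  induction n with
  | zero => assumption
  | succ n _ => exact isNoetherian_of_surjective (Z n) (LinearMap.range_eq_top.2 (hZ n))

theorem isNoetherian_of_ker_le_range (X : ∀ n, T n →ₗ[R] T (n + 1)) (P : ∀ n, T n →ₗ[R] U n)
    (hP : Function.Injective (P 0))
    (hPX : ∀ n, LinearMap.ker (P (n + 1)) ≤ LinearMap.range (X n))
    [∀ n, IsNoetherian R (U n)] (n : ℕ) : IsNoetherian R (T n) := by
  induction n with
  | zero => exact isNoetherian_of_injective _ hP
  | succ n _ =>
    have : IsNoetherian R (LinearMap.ker (P (n + 1))) := isNoetherian_of_le (hPX n)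
    exact isNoetherian_of_range_eq_ker _ (P (n + 1)) (Submodule.range_subtype _)

theorem eventually_map_eq_of_surjective_succ (Z : ∀ n, U n →ₗ[R] U (n + 1))
    (hZ : ∀ n, Function.Surjective (Z n)) [IsNoetherian R (U 0)] (p : ∀ n, Submodule R (U n))
    (hp : ∀ n, (p n).map (Z n) ≤ p (n + 1)) : ∀ᶠ n in atTop, (p n).map (Z n) = p (n + 1) := by
  let Zpow (n : ℕ) : U 0 →ₗ[R] U n := Nat.rec LinearMap.id (fun n f ↦ Z n ∘ₗ f) n
  have Zpow_surjective (n : ℕ) : Function.Surjective (Zpow n) := by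
    induction n with
    | zero => exact Function.surjective_id
    | succ n ih => exact (hZ n).comp ih
  have map_comap_Zpow (n : ℕ) : ((p n).comap (Zpow n)).map (Zpow n) = p n :=
    Submodule.map_comap_eq_of_surjective (Zpow_surjective n) _
  have hmono : Monotone fun n ↦ (p n).comap (Zpow n) :=
    monotone_nat_of_le_succ fun n ↦
      Submodule.comap_mono (f := Zpow n) (Submodule.map_le_iff_le_comap.1 (hp n))
  obtain ⟨N, hN⟩ := monotone_stabilizes_iff_noetherian.2 ‹IsNoetherian R (U 0)› ⟨_, hmono⟩
  filter_upwards [eventually_ge_atTop N] with n hn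
  have hstable : (p n).comap (Zpow n) = (p (n + 1)).comap (Zpow (n + 1)) :=
    (hN n hn).symm.trans (hN (n + 1) (by omega))
  calc (p n).map (Z n) = (((p n).comap (Zpow n)).map (Zpow n)).map (Z n) := by rw [map_comap_Zpow]
    _ = ((p n).comap (Zpow n)).map (Zpow (n + 1)) := (Submodule.map_comp _ _ _).symm
    _ = p (n + 1) := hstable ▸ map_comap_Zpow (n + 1)

theorem eventuallyGenerates_of_ker_le_range (X : Fin 2 → ∀ n, T n →ₗ[R] T (n + 1))
    (P : ∀ n, T n →ₗ[R] U n) (Z : ∀ n, U n →ₗ[R] U (n + 1))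
    (hZ : ∀ n, Function.Surjective (Z n)) [IsNoetherian R (U 0)]
    (hker : ∀ n, LinearMap.ker (P (n + 1)) ≤ LinearMap.range (X 0 n))
    (hPX : ∀ n, P (n + 1) ∘ₗ X 1 n = Z n ∘ₗ P n) : EventuallyGenerates X := by
  have hrange (n : ℕ) :
      (LinearMap.range (P n)).map (Z n) = (LinearMap.range (X 1 n)).map (P (n + 1)) := by
    rw [← LinearMap.range_comp, ← LinearMap.range_comp, hPX]
  filter_upwards [eventually_map_eq_of_surjective_succ Z hZ (fun n ↦ LinearMap.range (P n))
    fun n ↦ (hrange n).trans_le LinearMap.map_le_range] with n hn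
  refine eq_top_iff.2 fun t _ ↦ ?_
  obtain ⟨_, ⟨s, rfl⟩, hs⟩ : P (n + 1) t ∈ (LinearMap.range (X 1 n)).map (P (n + 1)) := by
    rw [← hrange, hn]
    exact LinearMap.mem_range_self _ t
  have hdiff : t - X 1 n s ∈ LinearMap.range (X 0 n) :=
    hker n (by rw [LinearMap.mem_ker, map_sub, hs, sub_self])
  rw [← sub_add_cancel t (X 1 n s)]
  exact add_mem (Submodule.mem_iSup_of_mem 0 hdiff)
    (Submodule.mem_iSup_of_mem 1 (LinearMap.mem_range_self _ s))

end GradedModules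

section YonedaOperators

variable {C : Type*} [Category* C] [Abelian C] [HasExt C] (R : Type*) [CommRing R] [Linear R C]

/-- Yoneda multiplication by a class in `Extᵈ(X, X)`, as an operator of degree `d` on
`Ext*(X, N)`. -/
noncomputable abbrev yonedaMul {X : C} {d : ℕ} (ξ : Ext X X d) (N : C) (n : ℕ) :
    Ext X N n →ₗ[R] Ext X N (n + d) :=
  ξ.precompOfLinear R N (add_comm d n)

theorem yonedaMul_comp {X : C} (ξ ζ : Ext X X 1) (N : C) (n : ℕ) :
    yonedaMul R ξ N (n + 1) ∘ₗ yonedaMul R ζ N n =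
      yonedaMul R (ξ.comp ζ one_add_one_eq_two) N n :=
  LinearMap.ext fun α ↦ (Ext.comp_assoc ξ ζ α _ (add_comm 1 n) (by omega)).symm

variable {S E P N : C} {i : S ⟶ E} {p : E ⟶ S} {w : i ≫ p = 0} {i' : E ⟶ P} {p' : P ⟶ E}
  {w' : i' ≫ p' = 0}

theorem ker_precomp_le_range_yonedaMul (hE : (ShortComplex.mk i p w).ShortExact) (n : ℕ) :
    LinearMap.ker ((Ext.mk₀ p).precompOfLinear R N (zero_add (n + 1))) ≤
      LinearMap.range (yonedaMul R hE.extClass N n) := fun α hα ↦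
  Ext.contravariant_sequence_exact₃ hE N α hα (add_comm 1 n)

theorem yonedaMul_extClass_surjective (hE : (ShortComplex.mk i p w).ShortExact)
    [∀ n, Subsingleton (Ext E N (n + 1))] (n : ℕ) :
    Function.Surjective (yonedaMul R hE.extClass N n) := fun _ ↦
  ker_precomp_le_range_yonedaMul R hE n (Subsingleton.elim (α := Ext E N (n + 1)) _ _)

theorem isNoetherian_ext_of_selfExtensions (hE : (ShortComplex.mk i p w).ShortExact)
    (hP : (ShortComplex.mk i' p' w').ShortExact) [∀ n, Subsingleton (Ext P N (n + 1))]
    [IsNoetherian R (E ⟶ N)] (n : ℕ) : IsNoetherian R (Ext S N n) := by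
  have : IsNoetherian R (Ext E N 0) := isNoetherian_of_linearEquiv Ext.linearEquiv₀.symm
  have := isNoetherian_of_surjective_succ (yonedaMul R hP.extClass N)
    (yonedaMul_extClass_surjective R hP)
  have := hE.epi_g
  exact isNoetherian_of_ker_le_range (yonedaMul R hE.extClass N)
    (fun n ↦ (Ext.mk₀ p).precompOfLinear R N (zero_add n)) (Ext.precomp_mk₀_injective_of_epi N p)
    (ker_precomp_le_range_yonedaMul R hE) n

theorem eventuallyGenerates_of_selfExtensions (hE : (ShortComplex.mk i p w).ShortExact)
    (hP : (ShortComplex.mk i' p' w').ShortExact) [∀ n, Subsingleton (Ext P N (n + 1))]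
    [IsNoetherian R (E ⟶ N)] {ξ : Fin 2 → Ext S S 1} (h₀ : ξ 0 = hE.extClass)
    (h₁ : (Ext.mk₀ p).comp (ξ 1) (zero_add 1) = hP.extClass.comp (Ext.mk₀ p) (add_zero 1)) :
    EventuallyGenerates fun j ↦ yonedaMul R (ξ j) N := by
  have : IsNoetherian R (Ext E N 0) := isNoetherian_of_linearEquiv Ext.linearEquiv₀.symm
  refine eventuallyGenerates_of_ker_le_range (fun j ↦ yonedaMul R (ξ j) N)
    (fun n ↦ (Ext.mk₀ p).precompOfLinear R N (zero_add n)) (yonedaMul R hP.extClass N)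
    (yonedaMul_extClass_surjective R hP)
    (by simpa only [h₀] using ker_precomp_le_range_yonedaMul R hE) fun n ↦ LinearMap.ext fun α ↦ ?_
  change (Ext.mk₀ p).comp ((ξ 1).comp α (add_comm 1 n)) (zero_add (n + 1)) =
    hP.extClass.comp ((Ext.mk₀ p).comp α (zero_add n)) (add_comm 1 n)
  rw [← Ext.comp_assoc (Ext.mk₀ p) (ξ 1) α (zero_add 1) _ (by omega), h₁,
    Ext.comp_assoc_of_second_deg_zero]

theorem precomp_retract_surjective {X Y : C} (h : Retract X Y) (N : C) (n : ℕ) :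
    Function.Surjective ((Ext.mk₀ h.i).precompOfLinear R N (zero_add n)) := fun α ↦
  ⟨(Ext.mk₀ h.r).comp α (zero_add n), by
    simp [Ext.precompOfLinear, Ext.mk₀_comp_mk₀_assoc]⟩

theorem EventuallyGenerates.of_retract {X Y : C} (h : Retract X Y) {ι : Type*} {d : ℕ}
    {ξ : ι → Ext Y Y d} {η : ι → Ext X X d}
    (hηξ : ∀ j, (η j).comp (Ext.mk₀ h.i) (add_zero d) = (Ext.mk₀ h.i).comp (ξ j) (zero_add d))
    (hξ : EventuallyGenerates fun j ↦ yonedaMul R (ξ j) N) :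
    EventuallyGenerates fun j ↦ yonedaMul R (η j) N := by
  refine hξ.of_surjective (fun n ↦ (Ext.mk₀ h.i).precompOfLinear R N (zero_add n))
    (precomp_retract_surjective R h N) fun j n ↦ LinearMap.ext fun α ↦ ?_
  change (η j).comp ((Ext.mk₀ h.i).comp α (zero_add n)) (add_comm d n) =
    (Ext.mk₀ h.i).comp ((ξ j).comp α (add_comm d n)) (zero_add (n + d))
  rw [← Ext.comp_assoc_of_second_deg_zero, hηξ,
    Ext.comp_assoc (Ext.mk₀ h.i) (ξ j) α (zero_add d) _ (by omega)]

variable {R} in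
theorem EventuallyGenerates.yonedaMul_comp {X : C} {ι : Type*} {ξ : ι → Ext X X 1}
    (hξ : EventuallyGenerates fun j ↦ yonedaMul R (ξ j) N) :
    EventuallyGenerates fun j : ι × ι ↦
      yonedaMul R ((ξ j.1).comp (ξ j.2) one_add_one_eq_two) N := by
  simpa only [ExtFG.yonedaMul_comp] using hξ.comp

end YonedaOperators

section Retracts

variable {C : Type*} [Category* C] [Abelian C] [HasExt C] {X Y : C}

/-- The class `ι ξ π` in `Ext*(X, X)` obtained from `ξ` in `Ext*(Y, Y)` when `X` is a retract of
`Y` with inclusion `ι` and retraction `π`. -/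
noncomputable def compress (h : Retract X Y) {d : ℕ} (ξ : Ext Y Y d) : Ext X X d :=
  (Ext.mk₀ h.i).comp (ξ.comp (Ext.mk₀ h.r) (add_zero d)) (zero_add d)

theorem compress_comp_mk₀ (h : Retract X Y) {d : ℕ} {ξ : Ext Y Y d}
    (hξ : (Ext.mk₀ (h.r ≫ h.i)).comp ξ (zero_add d) =
      ξ.comp (Ext.mk₀ (h.r ≫ h.i)) (add_zero d)) :
    (compress h ξ).comp (Ext.mk₀ h.i) (add_zero d) = (Ext.mk₀ h.i).comp ξ (zero_add d) := by
  rw [compress, Ext.comp_assoc_of_third_deg_zero, Ext.comp_assoc_of_third_deg_zero,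
    Ext.mk₀_comp_mk₀, ← hξ, Ext.mk₀_comp_mk₀_assoc, h.retract_assoc]

theorem mk₀_comp_comp_of_semiconj {X Y Z : C} {a b c : ℕ} {ξ : Ext X Y a} {ζ : Ext Y Z b}
    {e : X ⟶ X} {e' : Y ⟶ Y} {e'' : Z ⟶ Z} (hab : a + b = c)
    (hξ : (Ext.mk₀ e).comp ξ (zero_add a) = ξ.comp (Ext.mk₀ e') (add_zero a))
    (hζ : (Ext.mk₀ e').comp ζ (zero_add b) = ζ.comp (Ext.mk₀ e'') (add_zero b)) :
    (Ext.mk₀ e).comp (ξ.comp ζ hab) (zero_add c) =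
      (ξ.comp ζ hab).comp (Ext.mk₀ e'') (add_zero c) := by
  rw [← Ext.comp_assoc (Ext.mk₀ e) ξ ζ (zero_add a) hab (by omega), hξ,
    Ext.comp_assoc_of_second_deg_zero, hζ, ← Ext.comp_assoc_of_third_deg_zero]

end Retracts

section Bialgebra
section Representations

variable {k H : Type u} [Field k] [Ring H] [Algebra k H] {V : Type u} [AddCommGroup V] [Module k V]

/-- The `H`-module afforded by a representation `ρ` of the `k`-algebra `H`. -/
noncomputable def ofRep (ρ : H →ₐ[k] Module.End k V) : ModuleCat.{u} H :=
  @ModuleCat.of H _ V _ (Module.compHom V ρ.toRingHom)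

/-- The identification of the space of a representation with the module it affords. -/
noncomputable def ofRepEquiv (ρ : H →ₐ[k] Module.End k V) : V ≃ₗ[k] ofRep ρ where
  __ := AddEquiv.refl V
  map_smul' c v := (LinearMap.congr_fun (ρ.commutes c) v).symm

theorem smul_ofRepEquiv (ρ : H →ₐ[k] Module.End k V) (h : H) (v : V) :
    h • ofRepEquiv ρ v = ofRepEquiv ρ (ρ h v) := rfl

end Representations

namespace BialgMod

variable {k : Type u} [Field k] {H : Type u} [Ring H] [Bialgebra k H]

/-- The identification of `X ⊗ M` with the module underlying `(- ⊗ M)` applied to `X`. -/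
noncomputable def tensorEquiv (X M : ModuleCat.{u} H) :
    X ⊗[k] M ≃ₗ[k] (tensorFunctor k M).obj X :=
  ofRepEquiv (action k X M)

instance (M : ModuleCat.{u} H) : (tensorFunctor k M).Linear k where
  map_smul {X Y} f c := by
    ext t
    exact (congrArg (tensorEquiv Y M)
      (LinearMap.congr_fun (LinearMap.rTensor_smul M c (f.hom.restrictScalars k)) t)).trans
        (map_smul (tensorEquiv Y M) c ((f.hom.restrictScalars k).rTensor M t))

theorem psi_smul (M : ModuleCat.{u} H) {n : ℕ} (c : k) (ζ : Ext (triv k H) (triv k H) n) :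
    psi k M n (c • ζ) = c • psi k M n ζ := by
  simp only [psi, Functor.mapExactFunctor_smul, Ext.smul_comp, Ext.comp_smul]

/-- The homogeneous element of `Ext*(M, N)` given by a class in `Extⁿ(M, N)`. -/
noncomputable def ofExt (M N : ModuleCat.{u} H) (n : ℕ) : Ext M N n →+ ExtMod M N :=
  DirectSum.of (fun n : ℕ ↦ Ext M N n) n

theorem ofExt_psi_comp (M N : ModuleCat.{u} H) {a b n : ℕ} (h : a + b = n)
    (ζ : Ext (triv k H) (triv k H) a) (α : Ext M N b) :
    ofExt M N n ((psi k M a ζ).comp α h) =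
      (DirectSum.of (fun n : ℕ ↦ Ext (triv k H) (triv k H) n) a ζ : ExtAlg k H) •
        ofExt M N b α := by
  subst h
  exact (of_smul_of k M N ζ α).symm

theorem ofExt_smul (M N : ModuleCat.{u} H) {n : ℕ} (c : k) (α : Ext M N n) :
    ofExt M N n (c • α) =
      (DirectSum.of (fun n : ℕ ↦ Ext (triv k H) (triv k H) n) 0
        (c • Ext.mk₀ (𝟙 (triv k H))) : ExtAlg k H) • ofExt M N n α := by
  rw [← ofExt_psi_comp M N (zero_add n), psi_smul, psi_one, Ext.smul_comp, Ext.mk₀_id_comp]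

theorem finite_extMod_of_eventuallyGenerates {M N : ModuleCat.{u} H}
    (hfin : ∀ n, Module.Finite k (Ext M N n)) {ι : Type*} {d : ℕ} (hd : 0 < d)
    {η : ι → Ext (triv k H) (triv k H) d}
    (hη : EventuallyGenerates fun j ↦ yonedaMul k (psi k M d (η j)) N) :
    Module.Finite (ExtAlg k H) (ExtMod M N) := by
  obtain ⟨S, hS, hind⟩ := hη.exists_finite_generating_set hd
  let G : Set (ExtMod M N) := (fun s : Σ n, Ext M N n ↦ ofExt M N s.1 s.2) '' S
  let W : Submodule (ExtAlg k H) (ExtMod M N) := Submodule.span (ExtAlg k H) G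
  let p (n : ℕ) : Submodule k (Ext M N n) :=
    { W.toAddSubmonoid.comap (ofExt M N n) with
      smul_mem' c α hα := by
        change ofExt M N n (c • α) ∈ W
        rw [ofExt_smul]
        exact W.smul_mem _ hα }
  have hp (n : ℕ) : p n = ⊤ := by
    refine hind p (fun j n ↦ ?_) (fun s hs ↦ Submodule.subset_span (Set.mem_image_of_mem _ hs)) n
    rintro _ ⟨α, hα, rfl⟩
    change ofExt M N (n + d) ((psi k M d (η j)).comp α (add_comm d n)) ∈ W
    rw [ofExt_psi_comp]
    exact W.smul_mem _ hα
  refine Module.finite_def.2 (Submodule.fg_def.2 ⟨G, hS.image _, eq_top_iff.2 fun t _ ↦ ?_⟩)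
  exact DirectSum.induction_on (motive := fun t ↦ t ∈ W) t W.zero_mem
    (fun n α ↦ (hp n).ge (Submodule.mem_top (x := α))) fun _ _ ↦ W.add_mem

end BialgMod

theorem finiteType_of_eventuallyGenerates (k : Type u) {H : Type u} [Field k] [Ring H]
    [Algebra k H] {X : ModuleCat.{u} H} (hfin : ∀ n, Module.Finite k (Ext X X n)) {ι : Type*}
    [Finite ι] {d : ℕ} (hd : 0 < d) {ξ : ι → Ext X X d}
    (hξ : EventuallyGenerates fun j ↦ yonedaMul k (ξ j) X) :
    Algebra.FiniteType k (⨁ n : ℕ, Ext X X n) := by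
  obtain ⟨S, hS, hind⟩ := hξ.exists_finite_generating_set hd
  let of (n : ℕ) : Ext X X n →ₗ[k] ⨁ n : ℕ, Ext X X n := DirectSum.lof k ℕ _ n
  let G : Set (⨁ n : ℕ, Ext X X n) :=
    (fun s : Σ n, Ext X X n ↦ of s.1 s.2) '' S ∪ Set.range fun j ↦ of d (ξ j)
  let W : Subalgebra k (⨁ n : ℕ, Ext X X n) := Algebra.adjoin k G
  have hp (n : ℕ) : W.toSubmodule.comap (of n) = ⊤ := by
    refine hind (fun n ↦ W.toSubmodule.comap (of n)) (fun j n ↦ ?_)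
      (fun s hs ↦ Algebra.subset_adjoin (Or.inl (Set.mem_image_of_mem _ hs))) n
    rintro _ ⟨α, hα, rfl⟩
    have hmul : of (n + d) ((ξ j).comp α (add_comm d n)) = of d (ξ j) * of n α :=
      (DirectSum.of_eq_of_gradedMonoid_eq (ExtRingOf.mk_comp (ξ j) α (add_comm d n) rfl)).trans
        (DirectSum.of_mul_of (ξ j) α).symm
    change of (n + d) ((ξ j).comp α (add_comm d n)) ∈ W
    rw [hmul]
    exact W.mul_mem (Algebra.subset_adjoin (Or.inr ⟨j, rfl⟩)) hα
  refine ⟨Subalgebra.fg_def.2 ⟨G, (hS.image _).union (Set.finite_range _),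
    eq_top_iff.2 fun t _ ↦ ?_⟩⟩
  exact DirectSum.induction_on (motive := fun t ↦ t ∈ W) t W.zero_mem
    (fun n α ↦ (hp n).ge (Submodule.mem_top (x := α))) fun _ _ ↦ W.add_mem

namespace BialgMod
variable {k : Type u} [Field k] {H : Type u} [Ring H] [Bialgebra k H]

/-- If `k` is a retract of `S`, then `M ≅ k ⊗ M` is a retract of `S ⊗ M`. -/
@[simps]
noncomputable def tensorRetract {S : ModuleCat.{u} H} (h : Retract (triv k H) S)
    (M : ModuleCat.{u} H) : Retract M ((tensorFunctor k M).obj S) where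
  i := (lidIso k M).inv ≫ (tensorFunctor k M).map h.i
  r := (tensorFunctor k M).map h.r ≫ (lidIso k M).hom
  retract := by simp [← Functor.map_comp_assoc]

theorem psi_comp_tensorRetract_i {S : ModuleCat.{u} H} (h : Retract (triv k H) S) {d : ℕ}
    {η : Ext (triv k H) (triv k H) d} {ξ : Ext S S d}
    (hηξ : η.comp (Ext.mk₀ h.i) (add_zero d) = (Ext.mk₀ h.i).comp ξ (zero_add d))
    (M : ModuleCat.{u} H) :
    (psi k M d η).comp (Ext.mk₀ (tensorRetract h M).i) (add_zero d) =
      (Ext.mk₀ (tensorRetract h M).i).comp (ξ.mapExactFunctor (tensorFunctor k M))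
        (zero_add d) := by
  have hF := congrArg (Ext.mapExactFunctor (tensorFunctor k M)) hηξ
  rw [Ext.mapExactFunctor_comp, Ext.mapExactFunctor_comp, Ext.mapExactFunctor_mk₀] at hF
  rw [psi, tensorRetract_i, Ext.comp_assoc_of_third_deg_zero, Ext.comp_assoc_of_third_deg_zero,
    Ext.mk₀_comp_mk₀, Iso.hom_inv_id_assoc, hF, Ext.mk₀_comp_mk₀_assoc]

variable {S E P N : ModuleCat.{u} H} {i : S ⟶ E} {p : E ⟶ S} {w : i ≫ p = 0}
  {i' : E ⟶ P} {p' : P ⟶ E} {w' : i' ≫ p' = 0}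

theorem finite_ext_of_selfExtensions (hE : (ShortComplex.mk i p w).ShortExact)
    (hP : (ShortComplex.mk i' p' w').ShortExact) (h : Retract (triv k H) S) (M : ModuleCat.{u} H)
    [Projective ((tensorFunctor k M).obj P)] [Module.Finite k ((tensorFunctor k M).obj E ⟶ N)]
    (n : ℕ) : Module.Finite k (Ext M N n) := by
  have := Ext.subsingleton_of_projective ((tensorFunctor k M).obj P) N
  have := isNoetherian_ext_of_selfExtensions k (N := N) (hE.map_of_exact (tensorFunctor k M))
    (hP.map_of_exact (tensorFunctor k M)) n
  exact Module.Finite.of_surjective _ (precomp_retract_surjective k (tensorRetract h M) N n)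

theorem eventuallyGenerates_psi_of_selfExtensions (hE : (ShortComplex.mk i p w).ShortExact)
    (hP : (ShortComplex.mk i' p' w').ShortExact) {ξ : Fin 2 → Ext S S 1}
    (h₀ : ξ 0 = hE.extClass)
    (h₁ : (Ext.mk₀ p).comp (ξ 1) (zero_add 1) = hP.extClass.comp (Ext.mk₀ p) (add_zero 1))
    (h : Retract (triv k H) S) {e' : S ⟶ S}
    (he : ∀ j, (Ext.mk₀ (h.r ≫ h.i)).comp (ξ j) (zero_add 1) =
      (ξ j).comp (Ext.mk₀ e') (add_zero 1))
    (he' : ∀ j, (Ext.mk₀ e').comp (ξ j) (zero_add 1) =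
      (ξ j).comp (Ext.mk₀ (h.r ≫ h.i)) (add_zero 1)) (M : ModuleCat.{u} H)
    [Projective ((tensorFunctor k M).obj P)] [Module.Finite k ((tensorFunctor k M).obj E ⟶ N)] :
    EventuallyGenerates fun j : Fin 2 × Fin 2 ↦ yonedaMul k
      (psi k M 2 (compress h ((ξ j.1).comp (ξ j.2) one_add_one_eq_two))) N := by
  have := Ext.subsingleton_of_projective ((tensorFunctor k M).obj P) N
  have hgen : EventuallyGenerates fun j ↦
      yonedaMul k ((ξ j).mapExactFunctor (tensorFunctor k M)) N := by
    refine eventuallyGenerates_of_selfExtensions k (hE.map_of_exact (tensorFunctor k M))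
      (hP.map_of_exact (tensorFunctor k M)) ?_ ?_
    · exact (congrArg _ h₀).trans (Ext.mapExactFunctor_extClass _ hE)
    · have hF := congrArg (Ext.mapExactFunctor (tensorFunctor k M)) h₁
      rwa [Ext.mapExactFunctor_comp, Ext.mapExactFunctor_comp, Ext.mapExactFunctor_mk₀,
        Ext.mapExactFunctor_extClass] at hF
  refine EventuallyGenerates.of_retract k (tensorRetract h M) (fun j ↦ ?_) hgen.yonedaMul_comp
  rw [← Ext.mapExactFunctor_comp]
  exact psi_comp_tensorRetract_i h
    (compress_comp_mk₀ h (mk₀_comp_comp_of_semiconj one_add_one_eq_two (he j.1) (he' j.2))) M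

end BialgMod
end Bialgebra

section Generators

variable {k H X Y : Type*} [CommSemiring k] [Semiring H] [Algebra k H] {S : Set H}
  [AddCommMonoid X] [Module k X] [Module H X] [IsScalarTower k H X]
  [AddCommMonoid Y] [Module k Y] [Module H Y] [IsScalarTower k H Y]

theorem smul_mem_of_adjoin_eq_top (hS : Algebra.adjoin k S = ⊤) {p : Submodule k X}
    (hp : ∀ s ∈ S, ∀ x ∈ p, s • x ∈ p) (h : H) {x : X} (hx : x ∈ p) : h • x ∈ p := by
  have hh : h ∈ Algebra.adjoin k S := hS ▸ Algebra.mem_top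
  induction hh using Algebra.adjoin_induction generalizing x with
  | mem s hs => exact hp s hs x hx
  | algebraMap c => simpa only [algebraMap_smul] using p.smul_mem c hx
  | add a b _ _ ha hb => simpa only [add_smul] using p.add_mem (ha hx) (hb hx)
  | mul a b _ _ ha hb => simpa only [mul_smul] using ha (hb hx)

theorem map_smul_of_adjoin_eq_top (hS : Algebra.adjoin k S = ⊤) (f : X →ₗ[k] Y)
    (hf : ∀ s ∈ S, ∀ x, f (s • x) = s • f x) (h : H) (x : X) : f (h • x) = h • f x := by
  have hh : h ∈ Algebra.adjoin k S := hS ▸ Algebra.mem_top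
  induction hh using Algebra.adjoin_induction generalizing x with
  | mem s hs => exact hf s hs x
  | algebraMap c => simp only [algebraMap_smul, map_smul]
  | add a b _ _ ha hb => simp only [add_smul, map_add, ha, hb]
  | mul a b _ _ ha hb => simp only [mul_smul, ha, hb]

end Generators

instance finite_moduleCat_hom {k H : Type u} [Field k] [Ring H] [Algebra k H]
    (M N : ModuleCat.{u} H) [Module.Finite k M] [Module.Finite k N] :
    Module.Finite k (M ⟶ N) :=
  Module.Finite.of_injective
    ({ toFun := fun f ↦ f.hom.restrictScalars k
       map_add' := fun _ _ ↦ rfl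
       map_smul' := fun _ _ ↦ rfl } : (M ⟶ N) →ₗ[k] (M →ₗ[k] N))
    fun _ _ h ↦ ModuleCat.hom_ext (LinearMap.restrictScalars_injective k h)

namespace AlgB

variable (k : Type u) [Field k]

theorem adjoin_range_y : Algebra.adjoin k (Set.range (y k)) = ⊤ := by
  have h := congrArg (Subalgebra.map (RingQuot.mkAlgHom k (ExtRel k)))
    (FreeAlgebra.adjoin_range_ι k (Fin 2))
  rwa [AlgHom.map_adjoin, ← Set.range_comp, Algebra.map_top,
    (AlgHom.range_eq_top _).2 (RingQuot.mkAlgHom_surjective k (ExtRel k))] at h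

theorem span_eq_top :
    Submodule.span k (Set.range ![1, y k 0, y k 1, y k 0 * y k 1]) = ⊤ := by
  set p := Submodule.span k (Set.range ![1, y k 0, y k 1, y k 0 * y k 1])
  have mem (j : Fin 4) : ![1, y k 0, y k 1, y k 0 * y k 1] j ∈ p :=
    Submodule.subset_span ⟨j, rfl⟩
  have h10 : y k 1 * y k 0 = -(y k 0 * y k 1) := eq_neg_of_add_eq_zero_right (y_anticomm k)
  have hy (i : Fin 2) (x : AlgB k) (hx : x ∈ p) : y k i * x ∈ p := by
    refine (Submodule.span_le (p := p.comap (LinearMap.mulLeft k (y k i)))).2 ?_ hx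
    rintro _ ⟨j, rfl⟩
    change y k i * _ ∈ p
    fin_cases i <;> fin_cases j
    · simpa using mem 1
    · simp [y_sq]
    · exact mem 3
    · simp [← mul_assoc, y_sq]
    · simpa using mem 2
    · simpa [h10] using mem 3
    · simp [y_sq]
    · simp [← mul_assoc, h10, mul_assoc _ (y k 1), y_sq]
  refine eq_top_iff.2 fun b _ ↦ mul_one b ▸
    smul_mem_of_adjoin_eq_top (adjoin_range_y k) ?_ b (mem 0)
  rintro _ ⟨i, rfl⟩
  exact hy i

instance : Module.Finite k (AlgB k) :=
  Module.finite_def.2 (span_eq_top k ▸ Submodule.fg_span (Set.finite_range _))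

theorem finrank_le : Module.finrank k (AlgB k) ≤ 4 := by
  rw [← finrank_top, ← span_eq_top k]
  exact finrank_range_le_card _

end AlgB

namespace AlgA

variable (k : Type u) [Field k]

theorem adjoin_insert_g_range_y :
    Algebra.adjoin k (insert (g k) (Set.range (y k))) = ⊤ := by
  set W := Algebra.adjoin k (insert (g k) (Set.range (y k)))
  let F : AlgA k →ₐ[k] W :=
    lift (fun i ↦ ⟨y k i, Algebra.subset_adjoin (Or.inr ⟨i, rfl⟩)⟩)
      ⟨g k, Algebra.subset_adjoin (Or.inl rfl)⟩ (fun i ↦ Subtype.ext (y_sq k i))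
      (Subtype.ext (y_anticomm k)) (Subtype.ext (g_sq k)) (fun i ↦ Subtype.ext (g_mul_y k i))
  have hF : W.val.comp F = AlgHom.id k _ :=
    algHom_ext (fun i ↦ by simp [F]) (by simp [F])
  refine eq_top_iff.2 fun a _ ↦ ?_
  rw [← show (F a : AlgA k) = a from DFunLike.congr_fun hF a]
  exact (F a).2

instance : Module.Finite k (AlgA k) :=
  Module.Finite.equiv (SkewMonoidAlgebra.coeffLinearEquiv (S := k)).symm

theorem finrank_le : Module.finrank k (AlgA k) ≤ 8 := by
  rw [((SkewMonoidAlgebra.coeffLinearEquiv (S := k)).trans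
    (Finsupp.linearEquivFunOnFinite k (AlgB k) C2)).finrank_eq, Module.finrank_pi_fintype]
  exact Finset.sum_le_card_nsmul Finset.univ _ 4 fun _ _ ↦ AlgB.finrank_le k

variable {k}

section
variable {X Y : Type*} [AddCommGroup X] [Module k X] [Module (AlgA k) X]
  [IsScalarTower k (AlgA k) X] [AddCommGroup Y] [Module k Y] [Module (AlgA k) Y]
  [IsScalarTower k (AlgA k) Y]

theorem map_smul_of_generators (f : X →ₗ[k] Y) (hy : ∀ i x, f (y k i • x) = y k i • f x)
    (hg : ∀ x, f (g k • x) = g k • f x) (a : AlgA k) (x : X) : f (a • x) = a • f x := by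
  refine map_smul_of_adjoin_eq_top (adjoin_insert_g_range_y k) f ?_ a x
  rintro _ (rfl | ⟨i, rfl⟩)
  exacts [hg, hy i]

end
end AlgA

section Cones
open AlgA

variable {k : Type u} [Field k] {V W : Type u} [AddCommGroup V] [Module k V] [AddCommGroup W]
  [Module k W]

/-- The homomorphism of `A`-modules given by a `k`-linear map that commutes with the generators. -/
noncomputable def homOfGenerators {X Y : ModuleCat.{u} (AlgA k)} (f : X →ₗ[k] Y)
    (hy : ∀ j x, f (y k j • x) = y k j • f x) (hg : ∀ x, f (g k • x) = g k • f x) : X ⟶ Y :=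
  ModuleCat.ofHom { f with map_smul' := map_smul_of_generators f hy hg }

/-- A linear map between representations of `A` that commutes with the generators. -/
structure Intertwines (ρ : AlgA k →ₐ[k] Module.End k V) (σ : AlgA k →ₐ[k] Module.End k W)
    (f : V →ₗ[k] W) : Prop where
  y_apply (j : Fin 2) (v : V) : f (ρ (y k j) v) = σ (y k j) (f v)
  g_apply (v : V) : f (ρ (g k) v) = σ (g k) (f v)

/-- An endomorphism of a representation of `A` that anticommutes with the generators. -/
structure IsOdd (ρ : AlgA k →ₐ[k] Module.End k V) (s : Module.End k V) : Prop where
  y_apply (j : Fin 2) (v : V) : s (ρ (y k j) v) = -ρ (y k j) (s v)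
  g_apply (v : V) : s (ρ (g k) v) = -ρ (g k) (s v)

variable {ρ : AlgA k →ₐ[k] Module.End k V} {σ : AlgA k →ₐ[k] Module.End k W}
  {s : Module.End k V} {t : Module.End k W}

/-- The homomorphism of `A`-modules given by an intertwiner. -/
noncomputable def Intertwines.hom {f : V →ₗ[k] W} (hf : Intertwines ρ σ f) :
    ofRep ρ ⟶ ofRep σ :=
  homOfGenerators ((ofRepEquiv σ).toLinearMap ∘ₗ f ∘ₗ (ofRepEquiv ρ).symm.toLinearMap)
    (fun j v ↦ congrArg (ofRepEquiv σ) (hf.y_apply j ((ofRepEquiv ρ).symm v)))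
    fun v ↦ congrArg (ofRepEquiv σ) (hf.g_apply ((ofRepEquiv ρ).symm v))

/-- The self-extension `V × V` of a representation `V` of `A` defined by an odd endomorphism `s`:
the generator `yᵢ` acts by `(v, w) ↦ (yᵢ v, yᵢ w + s v)`, the other generators act diagonally. The
second factor is the subrepresentation and the first one the quotient. -/
noncomputable def cone (hs : IsOdd ρ s) (i : Fin 2) : AlgA k →ₐ[k] Module.End k (V × V) :=
  lift
    (fun j ↦ (ρ (y k j)).prodMap (ρ (y k j)) +
      if j = i then LinearMap.inr k V V ∘ₗ s ∘ₗ LinearMap.fst k V V else 0)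
    ((ρ (g k)).prodMap (ρ (g k)))
    (fun j ↦ LinearMap.ext fun v ↦ by
      have h (v : V) : ρ (y k j) (ρ (y k j) v) = 0 := by
        rw [← Module.End.mul_apply, ← map_mul, y_sq, map_zero, LinearMap.zero_apply]
      split_ifs <;> simp [h, hs.y_apply])
    (LinearMap.ext fun v ↦ by
      have h (v : V) : ρ (y k 0) (ρ (y k 1) v) = -ρ (y k 1) (ρ (y k 0) v) :=
        eq_neg_of_add_eq_zero_left <| by
          simpa using LinearMap.congr_fun (congrArg ρ (y_anticomm k)) v
      fin_cases i <;> simp [h, hs.y_apply] <;> abel)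
    (LinearMap.ext fun v ↦ by
      have h (v : V) : ρ (g k) (ρ (g k) v) = v := by
        rw [← Module.End.mul_apply, ← map_mul, g_sq, map_one, Module.End.one_apply]
      simp [h])
    fun j ↦ LinearMap.ext fun v ↦ by
      have h (v : V) : ρ (g k) (ρ (y k j) v) = -ρ (y k j) (ρ (g k) v) := by
        simpa using LinearMap.congr_fun (congrArg ρ (g_mul_y k j)) v
      split_ifs <;> simp [h, hs.g_apply, add_comm]

theorem cone_y (hs : IsOdd ρ s) (i j : Fin 2) (v : V × V) :
    cone hs i (y k j) v =
      (ρ (y k j) v.1, ρ (y k j) v.2 + if j = i then s v.1 else 0) := by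
  rw [cone, lift_y]
  split_ifs <;> simp

theorem cone_g (hs : IsOdd ρ s) (i : Fin 2) (v : V × V) :
    cone hs i (g k) v = (ρ (g k) v.1, ρ (g k) v.2) := by
  rw [cone, lift_g, LinearMap.prodMap_apply]

theorem intertwines_inr (hs : IsOdd ρ s) (i : Fin 2) :
    Intertwines ρ (cone hs i) (LinearMap.inr k V V) where
  y_apply j v := by simp [cone_y]
  g_apply v := by simp [cone_g]

theorem intertwines_fst (hs : IsOdd ρ s) (i : Fin 2) :
    Intertwines (cone hs i) ρ (LinearMap.fst k V V) where
  y_apply j v := by simp [cone_y]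
  g_apply v := by simp [cone_g]

theorem Intertwines.prodMap {f f' : V →ₗ[k] W} (hf : Intertwines ρ σ f)
    (hf' : Intertwines ρ σ f') (hs : IsOdd ρ s) (ht : IsOdd σ t) (hst : f' ∘ₗ s = t ∘ₗ f)
    (i : Fin 2) : Intertwines (cone hs i) (cone ht i) (f.prodMap f') where
  y_apply j v := by
    have hv : f' (s v.1) = t (f v.1) := LinearMap.congr_fun hst v.1
    rw [LinearMap.prodMap_apply, LinearMap.prodMap_apply, cone_y, cone_y, map_add, hf.y_apply,
      hf'.y_apply, apply_ite f', hv, map_zero]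
  g_apply v := by
    rw [LinearMap.prodMap_apply, LinearMap.prodMap_apply, cone_g, cone_g, hf.g_apply, hf'.g_apply]

theorem IsOdd.prodMap_neg (hs : IsOdd ρ s) (i : Fin 2) : IsOdd (cone hs i) (s.prodMap (-s)) where
  y_apply j v := by
    simp only [LinearMap.prodMap_apply, cone_y, hs.y_apply]
    split_ifs <;> simp [hs.y_apply, add_comm]
  g_apply v := by simp [cone_g, hs.g_apply]

theorem shortExact_cone (hs : IsOdd ρ s) (i : Fin 2) :
    (ShortComplex.mk (intertwines_inr hs i).hom (intertwines_fst hs i).hom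
      (ModuleCat.hom_ext (LinearMap.ext fun _ ↦ rfl))).ShortExact := by
  refine ShortComplex.ShortExact.mk' ?_ ?_ ?_
  · rw [ShortComplex.ShortExact.moduleCat_exact_iff_function_exact]
    exact (Function.Exact.inr_fst : Function.Exact (LinearMap.inr k V V) (LinearMap.fst k V V))
  · exact (ModuleCat.mono_iff_injective _).2 (LinearMap.inr_injective (R := k) (M := V) (M₂ := V))
  · exact (ModuleCat.epi_iff_surjective _).2 (LinearMap.fst_surjective (R := k) (M := V) (M₂ := V))

/-- The class in `Ext¹` of the self-extension defined by an odd endomorphism. -/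
noncomputable def coneClass (hs : IsOdd ρ s) (i : Fin 2) : Ext (ofRep ρ) (ofRep ρ) 1 :=
  (shortExact_cone hs i).extClass

theorem coneClass_comp_mk₀ (hs : IsOdd ρ s) (ht : IsOdd σ t) {f f' : V →ₗ[k] W}
    (hf : Intertwines ρ σ f) (hf' : Intertwines ρ σ f') (hst : f' ∘ₗ s = t ∘ₗ f) (i : Fin 2) :
    (coneClass hs i).comp (Ext.mk₀ hf'.hom) (add_zero 1) =
      (Ext.mk₀ hf.hom).comp (coneClass ht i) (zero_add 1) :=
  (shortExact_cone hs i).extClass_naturality (shortExact_cone ht i)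
    { τ₁ := hf'.hom
      τ₂ := (hf.prodMap hf' hs ht hst i).hom
      τ₃ := hf.hom
      comm₁₂ := ModuleCat.hom_ext <| LinearMap.ext fun v ↦
        congrArg (ofRepEquiv (cone ht i)) (Prod.ext (map_zero f).symm rfl :
          LinearMap.inr k W W (f' ((ofRepEquiv ρ).symm v)) =
            f.prodMap f' (LinearMap.inr k V V ((ofRepEquiv ρ).symm v)))
      comm₂₃ := ModuleCat.hom_ext <| LinearMap.ext fun _ ↦ rfl }

/-- The vector `v` generates the representation `ρ` of `A`. -/
def IsCyclicVector (ρ : AlgA k →ₐ[k] Module.End k V) (v : V) : Prop :=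
  ∀ p : Submodule k V, (∀ j, ∀ x ∈ p, ρ (y k j) x ∈ p) → (∀ x ∈ p, ρ (g k) x ∈ p) → v ∈ p → p = ⊤

theorem IsCyclicVector.cone {v : V} (hv : IsCyclicVector ρ v) (hs : IsOdd ρ s)
    (hsurj : Function.Surjective s) {i : Fin 2} (hi : ρ (y k i) v = 0) :
    IsCyclicVector (cone hs i) (v, 0) := by
  intro p hy hg hvp
  have hsub : p.comap (LinearMap.inr k V V ∘ₗ s) = ⊤ := by
    refine hv _ (fun j x hx ↦ ?_) (fun x hx ↦ ?_) ?_
    · have := p.neg_mem (hy j _ hx)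
      simpa [cone_y, hs.y_apply] using this
    · have := p.neg_mem (hg _ hx)
      simpa [cone_g, hs.g_apply] using this
    · simpa [cone_y, hi] using hy i _ hvp
  have hinr (w : V) : (0, w) ∈ p := by
    obtain ⟨x, rfl⟩ := hsurj w
    exact hsub.ge (Submodule.mem_top (x := x))
  have hinl : p.comap (LinearMap.inl k V V) = ⊤ := by
    refine hv _ (fun j x hx ↦ ?_) (fun x hx ↦ ?_) hvp
    · have := p.sub_mem (hy j _ hx) (hinr (if j = i then s x else 0))
      simpa [cone_y] using this
    · simpa [cone_g] using hg _ hx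
  refine eq_top_iff.2 fun x _ ↦ ?_
  simpa using p.add_mem (hinl.ge (Submodule.mem_top (x := x.1))) (hinr x.2)

end Cones

instance finite_ofRep {k H V : Type u} [Field k] [Ring H] [Algebra k H] [AddCommGroup V]
    [Module k V] [Module.Finite k V] (ρ : H →ₐ[k] Module.End k V) : Module.Finite k (ofRep ρ) :=
  Module.Finite.equiv (ofRepEquiv ρ)

namespace BialgMod

instance finite_triv (k H : Type u) [Field k] [Ring H] [Bialgebra k H] :
    Module.Finite H (triv k H) :=
  have : Module.Finite k (triv k H) := Module.Finite.equiv (trivEquiv k).symm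
  Module.Finite.of_restrictScalars_finite k H (triv k H)

instance finite_tensorFunctor_obj {k H : Type u} [Field k] [Ring H] [Bialgebra k H]
    (X M : ModuleCat.{u} H) [Module.Finite k X] [Module.Finite k M] :
    Module.Finite k ((tensorFunctor k M).obj X) :=
  Module.Finite.equiv (tensorEquiv X M)

theorem smul_tensorEquiv {k H : Type u} [Field k] [Ring H] [Bialgebra k H]
    (X M : ModuleCat.{u} H) (h : H) (t : X ⊗[k] M) :
    h • tensorEquiv X M t = tensorEquiv X M (action k X M h t) :=
  smul_ofRepEquiv (action k X M) h t

end BialgMod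

namespace AlgA

variable (k : Type u) [Field k]

theorem comul_y (i : Fin 2) :
    Coalgebra.comul (R := k) (y k i) = 1 ⊗ₜ[k] y k i + y k i ⊗ₜ[k] g k := by
  change comulHom k (y k i) = _
  rw [comulHom, lift_y]

theorem comul_g : Coalgebra.comul (R := k) (g k) = g k ⊗ₜ[k] g k := by
  change comulHom k (g k) = _
  rw [comulHom, lift_g]

theorem counit_y (i : Fin 2) : Coalgebra.counit (R := k) (y k i) = 0 := by
  change counitHom k (y k i) = _
  rw [counitHom, lift_y]

theorem counit_g : Coalgebra.counit (R := k) (g k) = 1 := by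
  change counitHom k (g k) = _
  rw [counitHom, lift_g]

end AlgA

section Projectivity
open AlgA BialgMod

variable {k : Type u} [Field k]

theorem y_smul_tensorEquiv {X M : ModuleCat.{u} (AlgA k)} (i : Fin 2) (x : X) (m : M) :
    y k i • tensorEquiv X M (x ⊗ₜ[k] m) =
      tensorEquiv X M (x ⊗ₜ[k] (y k i • m)) + tensorEquiv X M ((y k i • x) ⊗ₜ[k] (g k • m)) := by
  rw [smul_tensorEquiv, action, AlgHom.comp_apply, AlgHom.comp_apply,
    Bialgebra.comulAlgHom_apply, comul_y]
  simp [Module.endTensorEndAlgHom_apply]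

theorem g_smul_tensorEquiv {X M : ModuleCat.{u} (AlgA k)} (x : X) (m : M) :
    g k • tensorEquiv X M (x ⊗ₜ[k] m) = tensorEquiv X M ((g k • x) ⊗ₜ[k] (g k • m)) := by
  rw [smul_tensorEquiv, action, AlgHom.comp_apply, AlgHom.comp_apply,
    Bialgebra.comulAlgHom_apply, comul_g]
  simp [Module.endTensorEndAlgHom_apply]

theorem projective_of_surjective_of_finrank_le {H : Type u} [Ring H] [Algebra k H]
    {X : ModuleCat.{u} H} {Q : Type u} [AddCommGroup Q] [Module k Q] [Module H Q]
    [IsScalarTower k H Q] [Module.Finite k Q] [Module.Projective H Q] (f : Q →ₗ[H] X)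
    (hf : Function.Surjective f) (h : Module.finrank k Q ≤ Module.finrank k X) :
    Projective X := by
  have hfinite : Module.Finite k X := Module.Finite.of_surjective (f.restrictScalars k) hf
  have hinj : Function.Injective (f.restrictScalars k) :=
    (LinearMap.injective_iff_surjective_of_finrank_eq_finrank
      (h.antisymm (LinearMap.finrank_le_finrank_of_surjective (f := f.restrictScalars k) hf))).2 hf
  have := Module.Projective.of_equiv (LinearEquiv.ofBijective f ⟨hinj, hf⟩)
  infer_instance

variable {V : Type u} [AddCommGroup V] [Module k V] {ρ : AlgA k →ₐ[k] Module.End k V} {v : V}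

theorem IsCyclicVector.tensorEquiv_tmul_mem (hv : IsCyclicVector ρ v)
    {M : ModuleCat.{u} (AlgA k)} {p : Submodule (AlgA k) ((tensorFunctor k M).obj (ofRep ρ))}
    (hp : ∀ m : M, tensorEquiv (ofRep ρ) M (ofRepEquiv ρ v ⊗ₜ[k] m) ∈ p) (w : V) (m : M) :
    tensorEquiv (ofRep ρ) M (ofRepEquiv ρ w ⊗ₜ[k] m) ∈ p := by
  let φ (m : M) : V →ₗ[k] (tensorFunctor k M).obj (ofRep ρ) :=
    (tensorEquiv (ofRep ρ) M).toLinearMap ∘ₗ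
      (TensorProduct.mk k (ofRep ρ) M).flip m ∘ₗ (ofRepEquiv ρ).toLinearMap
  have hgg (m : M) : g k • g k • m = m := by rw [← mul_smul, g_sq, one_smul]
  have hy (j : Fin 2) (x : V) (m : M) :
      φ m (ρ (y k j) x) = y k j • φ (g k • m) x - φ (y k j • g k • m) x := by
    simp [φ, y_smul_tensorEquiv, smul_ofRepEquiv, hgg]
  have hg (x : V) (m : M) : φ m (ρ (g k) x) = g k • φ (g k • m) x := by
    simp [φ, g_smul_tensorEquiv, smul_ofRepEquiv, hgg]
  have htop : ⨅ m, (p.restrictScalars k).comap (φ m) = ⊤ := by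
    refine hv _ (fun j x hx ↦ ?_) (fun x hx ↦ ?_) ((Submodule.mem_iInf _).2 hp)
    · refine (Submodule.mem_iInf _).2 fun m ↦ ?_
      rw [Submodule.mem_iInf] at hx
      change φ m (ρ (y k j) x) ∈ p
      exact hy j x m ▸ p.sub_mem (p.smul_mem _ (hx _)) (hx _)
    · refine (Submodule.mem_iInf _).2 fun m ↦ ?_
      rw [Submodule.mem_iInf] at hx
      change φ m (ρ (g k) x) ∈ p
      exact hg x m ▸ p.smul_mem _ (hx _)
  exact (Submodule.mem_iInf _).1 (htop.ge (Submodule.mem_top (x := w))) m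

theorem IsCyclicVector.projective_tensorFunctor_obj (hv : IsCyclicVector ρ v)
    [Module.Finite k V] (hV : Module.finrank k (AlgA k) ≤ Module.finrank k V)
    (M : ModuleCat.{u} (AlgA k)) [Module.Finite k M] :
    Projective ((tensorFunctor k M).obj (ofRep ρ)) := by
  let f : AlgA k ⊗[k] M →ₗ[AlgA k] (tensorFunctor k M).obj (ofRep ρ) :=
    TensorProduct.AlgebraTensorModule.lift <| LinearMap.toSpanSingleton (AlgA k) _ <|
      (tensorEquiv (ofRep ρ) M).toLinearMap ∘ₗ TensorProduct.mk k (ofRep ρ) M (ofRepEquiv ρ v)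
  have hf (m : M) : f (1 ⊗ₜ m) = tensorEquiv (ofRep ρ) M (ofRepEquiv ρ v ⊗ₜ[k] m) := by
    simp [f]
  refine projective_of_surjective_of_finrank_le (k := k) f (fun x ↦ ?_) ?_
  · obtain ⟨t, rfl⟩ := (tensorEquiv (ofRep ρ) M).surjective x
    rw [← Set.mem_range, ← LinearMap.coe_range, SetLike.mem_coe]
    induction t using TensorProduct.induction_on with
    | zero => simp
    | add t₁ t₂ h₁ h₂ => simpa only [map_add] using add_mem h₁ h₂
    | tmul w m =>
      obtain ⟨w, rfl⟩ := (ofRepEquiv ρ).surjective w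
      exact hv.tensorEquiv_tmul_mem (p := LinearMap.range f) (fun m ↦ ⟨_, hf m⟩) w m
  · rw [Module.finrank_tensorProduct, ← (tensorEquiv (ofRep ρ) M).finrank_eq,
      Module.finrank_tensorProduct, ← (ofRepEquiv ρ).finrank_eq]
    exact Nat.mul_le_mul_right _ hV

end Projectivity

section TrivialPlusSign
open AlgA BialgMod

variable (k : Type u) [Field k]

/-- The representation `k ⊕ k_sgn` of `A`: both `yᵢ` act by zero and `g` acts by `1` and `-1`. -/
noncomputable def trivSgn : AlgA k →ₐ[k] Module.End k (k × k) :=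
  lift (fun _ ↦ 0) (LinearMap.prodMap 1 (-1)) (by simp) (by simp)
    (LinearMap.ext fun _ ↦ by simp) (by simp)

theorem trivSgn_y (j : Fin 2) : trivSgn k (y k j) = 0 := by
  rw [trivSgn, lift_y]

theorem trivSgn_g (v : k × k) : trivSgn k (g k) v = (v.1, -v.2) := by
  rw [trivSgn, lift_g]
  simp

theorem isOdd_prodComm : IsOdd (trivSgn k) (LinearEquiv.prodComm k k k).toLinearMap where
  y_apply j v := by simp [trivSgn_y]
  g_apply v := by simp [trivSgn_g]

variable {k} in
theorem intertwines_trivSgn_prodMap (f f' : Module.End k k) :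
    Intertwines (trivSgn k) (trivSgn k) (f.prodMap f') where
  y_apply j v := by simp [trivSgn_y]
  g_apply v := by simp [trivSgn_g]

theorem isCyclicVector_trivSgn (hk : ringChar k ≠ 2) : IsCyclicVector (trivSgn k) (1, 1) := by
  intro p _ hg h₁
  have h₂ : (1, -1) ∈ p := by simpa [trivSgn_g] using hg _ h₁
  have two_ne_zero : (2 : k) ≠ 0 := Ring.two_ne_zero hk
  refine eq_top_iff.2 fun v _ ↦ ?_
  have hv : v = ((v.1 + v.2) / 2) • ((1, 1) : k × k) + ((v.1 - v.2) / 2) • ((1, -1) : k × k) := by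
    ext <;> simp <;> field_simp <;> ring
  exact hv ▸ p.add_mem (p.smul_mem _ h₁) (p.smul_mem _ h₂)

/-- The trivial module as a direct summand of `k ⊕ k_sgn`. -/
noncomputable def trivRetract : Retract (triv k (AlgA k)) (ofRep (trivSgn k)) where
  i := homOfGenerators
    ((ofRepEquiv _).toLinearMap ∘ₗ LinearMap.inl k k k ∘ₗ (trivEquiv k).toLinearMap)
    (fun j c ↦ by simp [trivEquiv_smul, counit_y, smul_ofRepEquiv, trivSgn_y])
    fun c ↦ by simp [trivEquiv_smul, counit_g, smul_ofRepEquiv, trivSgn_g]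
  r := homOfGenerators
    ((trivEquiv k).symm.toLinearMap ∘ₗ LinearMap.fst k k k ∘ₗ (ofRepEquiv _).symm.toLinearMap)
    (fun j v ↦ (trivEquiv k).injective <| by
      obtain ⟨v, rfl⟩ := (ofRepEquiv (trivSgn k)).surjective v
      simp [trivEquiv_smul, counit_y, smul_ofRepEquiv, trivSgn_y])
    fun v ↦ (trivEquiv k).injective <| by
      obtain ⟨v, rfl⟩ := (ofRepEquiv (trivSgn k)).surjective v
      simp [trivEquiv_smul, counit_g, smul_ofRepEquiv, trivSgn_g]
  retract := ModuleCat.hom_ext <| LinearMap.ext fun c ↦ (trivEquiv k).symm_apply_apply c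

theorem trivRetract_r_comp_i :
    (trivRetract k).r ≫ (trivRetract k).i = (intertwines_trivSgn_prodMap (k := k) 1 0).hom :=
  ModuleCat.hom_ext <| LinearMap.ext fun _ ↦ rfl

/-- The class `xᵢ` of the self-extension of `k ⊕ k_sgn` defined by `yᵢ` and the swap of the two
summands. -/
noncomputable def swapClass (i : Fin 2) : Ext (ofRep (trivSgn k)) (ofRep (trivSgn k)) 1 :=
  coneClass (isOdd_prodComm k) i

theorem mk₀_comp_swapClass (f f' : Module.End k k) (i : Fin 2) :
    (Ext.mk₀ (intertwines_trivSgn_prodMap f f').hom).comp (swapClass k i) (zero_add 1) =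
      (swapClass k i).comp (Ext.mk₀ (intertwines_trivSgn_prodMap f' f).hom) (add_zero 1) :=
  have hff' : f'.prodMap f ∘ₗ (LinearEquiv.prodComm k k k).toLinearMap =
      (LinearEquiv.prodComm k k k).toLinearMap ∘ₗ f.prodMap f' := LinearMap.ext fun _ ↦ rfl
  (coneClass_comp_mk₀ (isOdd_prodComm k) (isOdd_prodComm k) (intertwines_trivSgn_prodMap f f')
    (intertwines_trivSgn_prodMap f' f) hff' i).symm

/-- The class in `Ext²(k, k)` cut out of the product of two of the classes `xᵢ`. -/
noncomputable def degreeTwoClass (j : Fin 2 × Fin 2) : Ext (triv k (AlgA k)) (triv k (AlgA k)) 2 :=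
  compress (trivRetract k) ((swapClass k j.1).comp (swapClass k j.2) one_add_one_eq_two)

variable {k}

theorem projective_tensorFunctor_obj_cone_cone (hk : ringChar k ≠ 2)
    (M : ModuleCat.{u} (AlgA k)) [Module.Finite k M] :
    Projective ((tensorFunctor k M).obj (ofRep (cone ((isOdd_prodComm k).prodMap_neg 0) 1))) := by
  have hswap : Function.Surjective (LinearEquiv.prodComm k k k).toLinearMap :=
    (LinearEquiv.prodComm k k k).surjective
  have hE : IsCyclicVector (cone (isOdd_prodComm k) 0) ((1, 1), 0) :=
    (isCyclicVector_trivSgn k hk).cone _ hswap (by simp [trivSgn_y])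
  have hP : IsCyclicVector (cone ((isOdd_prodComm k).prodMap_neg 0) 1) (((1, 1), 0), 0) := by
    refine hE.cone _ ?_ (by simp [cone_y, trivSgn_y])
    exact hswap.prodMap (neg_surjective.comp hswap)
  exact hP.projective_tensorFunctor_obj ((AlgA.finrank_le k).trans (by simp)) M

variable (M N : ModuleCat.{u} (AlgA k)) [Module.Finite (AlgA k) M] [Module.Finite (AlgA k) N]

theorem finite_ext (hk : ringChar k ≠ 2) (n : ℕ) : Module.Finite k (Ext M N n) := by
  have : Module.Finite k M := Module.Finite.trans (AlgA k) M
  have : Module.Finite k N := Module.Finite.trans (AlgA k) N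
  have := projective_tensorFunctor_obj_cone_cone hk M
  exact finite_ext_of_selfExtensions (shortExact_cone (isOdd_prodComm k) 0)
    (shortExact_cone ((isOdd_prodComm k).prodMap_neg 0) 1) (trivRetract k) M n

theorem eventuallyGenerates_degreeTwoClass (hk : ringChar k ≠ 2) :
    EventuallyGenerates fun j ↦ yonedaMul k (psi k M 2 (degreeTwoClass k j)) N := by
  have : Module.Finite k M := Module.Finite.trans (AlgA k) M
  have : Module.Finite k N := Module.Finite.trans (AlgA k) N
  have := projective_tensorFunctor_obj_cone_cone hk M
  refine eventuallyGenerates_psi_of_selfExtensions (shortExact_cone (isOdd_prodComm k) 0)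
    (shortExact_cone ((isOdd_prodComm k).prodMap_neg 0) 1) (ξ := swapClass k) rfl
    (coneClass_comp_mk₀ _ (isOdd_prodComm k) (intertwines_fst _ 0) (intertwines_fst _ 0)
      (LinearMap.ext fun _ ↦ rfl) 1).symm
    (trivRetract k) (e' := (intertwines_trivSgn_prodMap 0 1).hom) ?_ ?_ M <;>
  · rw [trivRetract_r_comp_i]
    exact mk₀_comp_swapClass k _ _

end TrivialPlusSign

end ExtFG

theorem mainTheorem7 (k : Type u) [Field k] (hk : ringChar k ≠ 2) :
    Algebra.FiniteType k (ExtFG.BialgMod.ExtAlg k (ExtFG.AlgA k)) ∧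
      ∀ M N : ModuleCat.{u} (ExtFG.AlgA k),
        Module.Finite (ExtFG.AlgA k) M → Module.Finite (ExtFG.AlgA k) N →
          Module.Finite (ExtFG.BialgMod.ExtAlg k (ExtFG.AlgA k)) (ExtFG.BialgMod.ExtMod M N) := by
  constructor
  · exact ExtFG.finiteType_of_eventuallyGenerates k (ExtFG.finite_ext _ _ hk) two_pos
      (ExtFG.eventuallyGenerates_degreeTwoClass _ _ hk)
  · intro M N _ _
    exact ExtFG.BialgMod.finite_extMod_of_eventuallyGenerates (ExtFG.finite_ext M N hk) two_pos
      (ExtFG.eventuallyGenerates_degreeTwoClass M N hk)
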